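/- Let $n,d\ge 1$ and let $c_0,\dots,c_n\in\mathbb R[\gamma]$ be polynomials of degree at most $d$, not all identically zero, given by their coefficients. Put $p_\gamma(x)=\sum_{k=0}^n c_k(\gamma)x^k$ and let $m$ be the largest index with $c_m\not\equiv 0$. For a real polynomial $p=a_N\prod_{i=1}^N(x-x_i)$ of degree $N$ (with $x_i\in\mathbb C$) and $k\ge1$, the $k$-th subdiscriminant is $$\mathrm{sDisc}_k(p)=a_N^{2k-2}\sum_{S\subset\{1,\dots,N\},\,|S|=k}\ \prod_{\{i,j\}\subset S}(x_i-x_j)^2 ,$$ so that $\mathrm{sDisc}_k(p)=0$ for $k>N$. For $0\le k<N$ the $k$-th subresultant $\mathrm{sRes}_k(p,p')$ is the determinant of the first $2N-1-2k$ columns of the $(2N-1-2k)\times(2N-1-k)$ matrix whose first $N-1-k$ rows are the coefficient row $(a_N,\dots,a_0)$ of $p$ shifted to the right by $0,1,\dots,N-2-k$ places, and whose last $N-k$ rows are the coefficient row $(Na_N,\dots,a_1)$ of $p'$ shifted to the right by $N-1-k,\dots,1,0$ places. Algorithm FastRR works as follows, in exact real arithmetic. 1. Determine $m$, and find $2dn$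 distinct points $\gamma_1,\dots,\gamma_{2dn}\in\mathbb R$ with $c_m(\gamma_i)\ne0$ by testing the $2dn+d$ candidates $0,1,\dots,2dn+d-1$. 2. For each $i$ compute the coefficients of $p_{\gamma_i}$ and all the subresultants $\mathrm{sRes}_k(p_{\gamma_i},p_{\gamma_i}')$, $0\le k<m$, by a subresultant algorithm with a quadratic number of operations (the signed Euclidean algorithm). 3. For each $i$ compute the values $c_m(\gamma_i)^{-1}\,\mathrm{sRes}_{m-k}(p_{\gamma_i},p_{\gamma_i}')$ for $1\le k\le m$, and $0$ for $m<k\le n$. 4. For each $k=1,\dots,n$ let $q_k\in\mathbb R[\gamma]$ be the polynomial of degree less than $2dn$ that takes these values at $\gamma_1,\dots,\gamma_{2dn}$, and compute its coefficients by fast interpolation (divide-and-conquer Lagrange interpolation with Toom–Cook multiplication). Output $q_1,\dots,q_n$. **Theorem.** FastRR is correct: it never divides by zero; its points $\gamma_i$ are $2dn$ distinct real numbers with $c_m(\gamma_i)\neq 0$; in step 2 it computes all $\mathrm{sRes}_k(p_{\gamma_i},p_{\gamma_i}')$, $0\le k<m$; and its output consists of $n$ polynomials $q_1,\dots,q_n$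 of degree at most $2dn$ such that $q_k(\gamma)=\mathrm{sDisc}_k(p_\gamma)$ for every $k=1,\dots,n$ and every $\gamma\in\mathbb R$ with $c_m(\gamma)\ne0$. Moreover, FastRR runs in $O(n^4)$ time for $d=O(n)$: for every $\kappa$ there is a constant $A$, depending only on $\kappa$, such that whenever $d\le\kappa n$ the number of steps (arithmetic operations, loads of integer constants, and tests whether a number is zero) is at most $A\,n^4$. -/

import Mathlib

open Polynomial

/-! ## The polynomials: subdiscriminants and subresultants -/

/-- The `k`-th subdiscriminant `aₙ ^ (2k - 2) * ∑_{|S| = k} ∏_{{i,j} ⊆ S} (xᵢ - xⱼ)²` of a real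
polynomial with leading coefficient `aₙ` and complex roots `x₁, …, xₙ`, listed with multiplicity. -/
noncomputable def sDisc (k : ℕ) (p : ℝ[X]) : ℂ :=
  let x : List ℂ := (p.map (algebraMap ℝ ℂ)).roots.toList
  ((p.leadingCoeff : ℝ) : ℂ) ^ (2 * (k : ℤ) - 2) *
    ∑ S ∈ (Finset.univ : Finset (Fin x.length)).powersetCard k,
      ∏ i ∈ S, ∏ j ∈ S with i < j, (x.get i - x.get j) ^ 2

/-- The `j`-th entry of the row `0, …, 0, f_e, f_(e-1), …, f_0, 0, …, 0` with `s` leading zeros,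
where `f_i` is the coefficient of `X ^ i` in `f`. -/
noncomputable def shiftedRow (f : ℝ[X]) (e s j : ℕ) : ℝ :=
  if s ≤ j ∧ j ≤ e + s then f.coeff (e + s - j) else 0

/-- The `k`-th subresultant `sRes_k(p, p')` of a polynomial `p` of degree `n > k`: the determinant of
the first `2n - 1 - 2k` columns of the matrix whose first `n - 1 - k` rows are the coefficients of
`p` shifted by `0, 1, …, n - 2 - k`, and whose last `n - k` rows are the coefficients of `p'` shifted
by `n - 1 - k, …, 1, 0`. -/
noncomputable def sRes (k : ℕ) (p : ℝ[X]) : ℝ :=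
  let n := p.natDegree
  Matrix.det (Matrix.of fun i j : Fin (2 * n - 1 - 2 * k) =>
    if (i : ℕ) < n - 1 - k then shiftedRow p n i j
    else shiftedRow (derivative p) (n - 1) (2 * n - 2 - 2 * k - i) j)

/-- The member `p_γ(x) = ∑ₖ cₖ(γ) xᵏ` of the family with coefficients `c₀, …, cₙ ∈ ℝ[γ]`. -/
noncomputable def member {n : ℕ} (c : Fin (n + 1) → ℝ[X]) (γ : ℝ) : ℝ[X] :=
  ∑ k : Fin (n + 1), C ((c k).eval γ) * X ^ (k : ℕ)

/-- The polynomial with the given list of coefficients, constant coefficient first. -/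
noncomputable def ofCoeffs : List ℝ → ℝ[X]
  | [] => 0
  | a :: l => C a + X * ofCoeffs l

/-! ## The model of computation: exact field arithmetic with unit cost

A program over the type `K` of numbers can load an integer constant, perform one of the four
arithmetic operations, and branch on whether a number is zero. Programs below are written uniformly
in an unspecified type `K`, so that they have no other access to the numbers. -/

inductive ArithOp : Type
  | add | sub | mul | div

inductive Prog (K α : Type) : Type
  | ret (a : α) : Prog K α
  | const (z : ℤ) (next : K → Prog K α) : Prog K α
  | arith (o : ArithOp) (x y : K) (next : K → Prog K α) : Prog K α
  | test (x : K) (next : Bool → Prog K α) : Prog K α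

namespace Prog

/-- Running a program over a field: its result and the number of its steps (constants, arithmetic
operations and tests). A division by zero makes the run fail. -/
def run {F α : Type} [Field F] [DecidableEq F] : Prog F α → Option (α × ℕ)
  | ret a => some (a, 0)
  | const z next => (run (next (z : F))).map fun r => (r.1, r.2 + 1)
  | arith .add x y next => (run (next (x + y))).map fun r => (r.1, r.2 + 1)
  | arith .sub x y next => (run (next (x - y))).map fun r => (r.1, r.2 + 1)
  | arith .mul x y next => (run (next (x * y))).map fun r => (r.1, r.2 + 1)
  | arith .div x y next =>
      if y = 0 then none else (run (next (x / y))).map fun r => (r.1, r.2 + 1)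
  | test x next => (run (next (decide (x = 0)))).map fun r => (r.1, r.2 + 1)

/-- Sequential composition. -/
def seq {K α β : Type} : Prog K α → (α → Prog K β) → Prog K β
  | ret a, f => f a
  | const z next, f => const z fun v => seq (next v) f
  | arith o x y next, f => arith o x y fun v => seq (next v) f
  | test x next, f => test x fun b => seq (next b) f

instance {K : Type} : Monad (Prog K) where
  pure := ret
  bind := seq

variable {K : Type}

def int (z : ℤ) : Prog K K := const z ret
def add (x y : K) : Prog K K := arith .add x y ret
def sub (x y : K) : Prog K K := arith .sub x y ret
def mul (x y : K) : Prog K K := arith .mul x y ret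
def div (x y : K) : Prog K K := arith .div x y ret
def isZero (x : K) : Prog K Bool := test x ret

def mapList {α β : Type} (f : α → Prog K β) : List α → Prog K (List β)
  | [] => pure []
  | a :: l => do
    let b ← f a
    let bs ← mapList f l
    pure (b :: bs)

/-! ## Elementary operations on coefficient lists -/

def pow (x : K) : ℕ → Prog K K
  | 0 => int 1
  | e + 1 => do
    let y ← pow x e
    mul x y

def zeros (l : ℕ) : Prog K (List K) := do
  let z ← int 0
  pure (List.replicate l z)

def addL : List K → List K → Prog K (List K)
  | [], bs => pure bs
  | as, [] => pure as
  | a :: as, b :: bs => do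
    let s ← add a b
    let rest ← addL as bs
    pure (s :: rest)

def scaleL (x : K) (l : List K) : Prog K (List K) := mapList (mul x) l

def negL (l : List K) : Prog K (List K) := do
  let z ← int 0
  mapList (sub z) l

def divL (l : List K) (x : K) : Prog K (List K) := mapList (fun a => div a x) l

def subL (as bs : List K) : Prog K (List K) := do
  let nbs ← negL bs
  addL as nbs

/-- `l(X) + X ^ b * h(X)`, constant coefficients first. -/
def addShift (b : ℕ) (l h : List K) : Prog K (List K) := do
  let z ← zeros b
  addL l (z ++ h)

/-- Horner evaluation, constant coefficient first. -/
def evalAt : List K → K → Prog K K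
  | [], _ => int 0
  | a :: l, x => do
    let v ← evalAt l x
    let t ← mul x v
    add a t

def allZero : List K → Prog K Bool
  | [] => pure true
  | a :: l => do
    let z ← isZero a
    if z then allZero l else pure false

/-! ## Step 1: the leading coefficient and the evaluation points -/

/-- Deletes the rows behind the last row that is not zero. -/
def trimRows : List (List K) → Prog K (List (List K))
  | [] => pure []
  | r :: rs => do
    let rs' ← trimRows rs
    if rs'.isEmpty then do
      let z ← allZero r
      pure (if z then [] else [r])
    else pure (r :: rs')

/-- Tests the candidates and keeps the points at which the polynomial `top` does not vanish,
together with its values there. -/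
def goodPoints (top : List K) : List ℕ → Prog K (List (K × K))
  | [] => pure []
  | j :: js => do
    let x ← int j
    let v ← evalAt top x
    let z ← isZero v
    let rest ← goodPoints top js
    pure (if z then rest else (x, v) :: rest)

/-! ## Step 2: all subresultants of a polynomial and its derivative in quadratic time

The signed Euclidean algorithm, on polynomials with the leading coefficient first. -/

/-- The coefficients `k a₀, (k + 1) a₁, …`. -/
def derivFrom : ℕ → List K → Prog K (List K)
  | _, [] => pure []
  | k, a :: l => do
    let c ← int k
    let t ← mul c a
    let rest ← derivFrom (k + 1) l
    pure (t :: rest)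

/-- Subtracts `x` times the second list from the front of the first. -/
def subScaled (x : K) : List K → List K → Prog K (List K)
  | as, [] => pure as
  | [], _ => pure []
  | a :: as, b :: bs => do
    let t ← mul x b
    let s ← sub a t
    let rest ← subScaled x as bs
    pure (s :: rest)

/-- Long division by `b :: bs`: `s` division steps, each of which removes the leading entry. -/
def remLoop (b : K) (bs : List K) : ℕ → List K → Prog K (List K)
  | 0, as => pure as
  | _ + 1, [] => pure []
  | s + 1, a :: as => do
    let x ← div a b
    let as' ← subScaled x as bs
    remLoop b bs s as'

def stripZeros : List K → Prog K (List K)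
  | [] => pure []
  | a :: l => do
    let z ← isZero a
    if z then stripZeros l else pure (a :: l)

/-- The list of `μ * sRes_j(A, B)` for `j = deg A - 1, …, 0`, where `deg B < deg A`. With
`p = deg A`, `q = deg B`, `b` the leading coefficient of `B`, `R` the remainder of `A` by `B`,
`r = deg R` and `ε = (-1) ^ ((p - q) (p - q - 1) / 2)` it uses
`sRes_j(A, B) = 0` for `q < j < p`, `sRes_q(A, B) = ε b ^ (p - q)` and
`sRes_j(A, B) = ε b ^ (p - r) sRes_j(B, -R)` for `j < q`.
The first argument bounds the number of divisions. -/
def sResLoop : ℕ → K → List K → List K → Prog K (List K)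
  | 0, _, A, _ => zeros (A.length - 1)
  | _ + 1, _, A, [] => zeros (A.length - 1)
  | f + 1, μ, A, b :: bs => do
    let δ := A.length - (bs.length + 1)
    let ε ← int ((-1) ^ (δ * (δ - 1) / 2))
    let ν ← mul μ ε
    let y ← pow b δ
    let s ← mul ν y
    let z ← zeros (δ - 1)
    let R₀ ← remLoop b bs (δ + 1) A
    let R₁ ← negL R₀
    let R ← stripZeros R₁
    let w ← pow b (A.length - R.length)
    let μ' ← mul ν w
    let rest ← sResLoop f μ' (b :: bs) R
    pure (z ++ s :: rest)

/-- From the coefficients of `p`, constant coefficient first and leading coefficient nonzero, the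
list of `sRes_0(p, p'), …, sRes_(m-1)(p, p')`, where `m` is the degree of `p`. -/
def allSRes (p : List K) : Prog K (List K) := do
  let p' ← derivFrom 1 p.tail
  let one ← int 1
  let l ← sResLoop p.length one p.reverse p'.reverse
  pure l.reverse

/-! ## Step 4: fast interpolation

Lagrange interpolation by divide and conquer, on top of a fast (three-way Toom-Cook)
multiplication of polynomials. Constant coefficients come first. -/

/-- The product of two polynomials with at most `3 ^ k` coefficients each, from five products of
polynomials with at most `3 ^ (k - 1)` coefficients: evaluation at `0, 1, -1, 2, ∞`. -/
def toomCook : ℕ → List K → List K → Prog K (List K)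
  | _, [], _ => pure []
  | _, _, [] => pure []
  | 0, a :: _, b :: _ => do
    let t ← mul a b
    pure [t]
  | k + 1, a :: as, b :: bs => do
    let w := 3 ^ k
    let two ← int 2
    let three ← int 3
    let four ← int 4
    let sixteen ← int 16
    let a₀ := (a :: as).take w
    let a₁ := ((a :: as).drop w).take w
    let a₂ := (a :: as).drop (2 * w)
    let b₀ := (b :: bs).take w
    let b₁ := ((b :: bs).drop w).take w
    let b₂ := (b :: bs).drop (2 * w)
    -- values at 1 and -1
    let ea ← addL a₀ a₂
    let eb ← addL b₀ b₂
    let ap ← addL ea a₁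
    let bp ← addL eb b₁
    let am ← subL ea a₁
    let bm ← subL eb b₁
    -- values at 2
    let a₁' ← scaleL two a₁
    let a₂' ← scaleL four a₂
    let b₁' ← scaleL two b₁
    let b₂' ← scaleL four b₂
    let a₁₂ ← addL a₁' a₂'
    let b₁₂ ← addL b₁' b₂'
    let at₂ ← addL a₀ a₁₂
    let bt₂ ← addL b₀ b₁₂
    -- the five products
    let c₀ ← toomCook k a₀ b₀
    let rp ← toomCook k ap bp
    let rm ← toomCook k am bm
    let rt ← toomCook k at₂ bt₂
    let c₄ ← toomCook k a₂ b₂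
    -- interpolation
    let u ← addL rp rm
    let u ← divL u two
    let u ← subL u c₀
    let c₂ ← subL u c₄
    let v ← subL rp rm
    let v ← divL v two
    let t ← subL rt c₀
    let c₂' ← scaleL four c₂
    let t ← subL t c₂'
    let c₄' ← scaleL sixteen c₄
    let t ← subL t c₄'
    let t ← divL t two
    let t ← subL t v
    let c₃ ← divL t three
    let c₁ ← subL v c₃
    let h ← addShift w c₃ c₄
    let h ← addShift w c₂ h
    let h ← addShift w c₁ h
    addShift w c₀ h

def mulPoly (as bs : List K) : Prog K (List K) := do
  let l ← toomCook (Nat.clog 3 (max as.length bs.length)) as bs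
  pure (l.take (as.length + bs.length - 1))

/-- For a list of at most `2 ^ s` pairs `(xᵢ, uᵢ)`: the polynomials `∏ᵢ (X - xᵢ)` and
`∑ᵢ uᵢ ∏_{j ≠ i} (X - xⱼ)`. -/
def combine : ℕ → List (K × K) → Prog K (List K × List K)
  | _, [] => do
    let one ← int 1
    pure ([one], [])
  | 0, a :: _ => do
    let z ← int 0
    let y ← sub z a.1
    let one ← int 1
    pure ([y, one], [a.2])
  | s + 1, a :: l => do
    let r₁ ← combine s ((a :: l).take (2 ^ s))
    let r₂ ← combine s ((a :: l).drop (2 ^ s))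
    let M ← mulPoly r₁.1 r₂.1
    let F₁ ← mulPoly r₁.2 r₂.1
    let F₂ ← mulPoly r₂.2 r₁.1
    let F ← addL F₁ F₂
    pure (M, F)

/-- The product of `x - y` over the list of the `y`. -/
def prodDiff (x : K) : List K → Prog K K
  | [] => int 1
  | y :: l => do
    let t ← sub x y
    let r ← prodDiff x l
    mul t r

/-- For each point of the second list, the product of its differences to all the other points of
both lists. -/
def nodeWeights : List K → List K → Prog K (List K)
  | _, [] => pure []
  | pre, x :: post => do
    let w ← prodDiff x (pre ++ post)
    let ws ← nodeWeights (pre ++ [x]) post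
    pure (w :: ws)

/-- The interpolating polynomial for the values `vs` at the points `xs` with weights `ws`. -/
def interpolate (xs ws vs : List K) : Prog K (List K) := do
  let us ← mapList (fun a => div a.1 a.2) (vs.zip ws)
  let r ← combine (Nat.clog 2 xs.length) (xs.zip us)
  pure r.2

end Prog

/-! ## The algorithm FastRR -/

/-- What a run of the algorithm produces: the points `γᵢ`, for each of them the list of the
subresultants of `p_γᵢ`, and the coefficient lists of the output polynomials `q₁, …, qₙ`. -/
structure FastRRData (K : Type) where
  points : List K
  sres : List (List K)
  output : List (List K)

/-- The input is the matrix of the coefficients of `c₀, …, cₙ`: the entry `c k j` is the coefficient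
of `γ ^ j` in `cₖ(γ)`. -/
def fastRR {K : Type} (n d : ℕ) (c : Fin (n + 1) → Fin (d + 1) → K) :
    Prog K (FastRRData K) := do
  -- the coefficients `c₀, …, cₘ` up to the last one that is not identically zero
  let rows ← Prog.trimRows (List.ofFn fun k => List.ofFn (c k))
  match rows.getLast? with
  | none => pure ⟨[], [], []⟩
  | some top => do
    -- Step 1: `2 d n` points at which `cₘ` does not vanish, among `2 d n + d` candidates
    let good ← Prog.goodPoints top (List.range (2 * d * n + d))
    let nodes := good.take (2 * d * n)
    let points := nodes.map Prod.fst
    -- Step 2: the subresultants of `p_γ` at these points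
    let sres ← Prog.mapList (fun x => do
      let p ← Prog.mapList (fun row => Prog.evalAt row x) rows
      Prog.allSRes p) points
    -- Step 3: the values `q_k(γ) = cₘ(γ)⁻¹ * sRes_(m-k)(p_γ)` for `k = 1, …, m`,
    -- and `q_k(γ) = 0` for `k = m + 1, …, n`
    let values ← Prog.mapList (fun a => do
      let l ← Prog.divL a.2.reverse a.1
      let z ← Prog.zeros (n - l.length)
      pure (l ++ z)) ((nodes.map Prod.snd).zip sres)
    -- Step 4: interpolation of `q₁, …, qₙ`
    let weights ← Prog.nodeWeights [] points
    let output ← Prog.mapList (fun k =>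
      Prog.interpolate points weights (values.filterMap fun row => row[k]?)) (List.range n)
    pure ⟨points, sres, output⟩

/-! Correctness. Read coefficients from the leading one downwards, so that a polynomial of degree N
becomes a power series with constant term a_N. Then sRes_k(p, p') is a determinant `subdet` whose
rows are shifts of the two reversed series, cut off to a square. A common factor u of both series
comes out as a power of u(0) (`subdet_mul`), since multiplication by u acts on truncated series as a
triangular Toeplitz matrix. The reversed p' is the reversed p times the generating series of the
power sums of the roots (`reflect_derivative_prod_X_sub_C`). Removing the reversed p leaves
a_N^(2k+1) times the Hankel determinant of the power sums of size k+1, which by Cauchy–Binet is the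
sum of the squared Vandermonde minors. This gives sRes_(N-k-1) = a_N sDisc_(k+1)
(`sRes_eq_leadingCoeff_mul_sDisc`).

In the family, the first column of this matrix is c_m times constants, and the other 2k columns have
degree at most d in γ. So the quotient by c_m is a polynomial of degree at most 2kd < 2dn
(`exists_eval_eq_sRes_div`), and 2dn nodes determine it. At most d candidates are lost as roots of
c_m.

The same determinants explain the signed Euclidean algorithm: subtracting the quotient times the
divisor is a row operation, and the zeros that the remainder then has in front let columns be
expanded away (`subdet_remainder`, `listSRes_of_lt`).

Cost. There are N = 2dn = O(n^2) nodes. Evaluation and the Euclidean algorithm take O(n^2) at each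
node, and the Lagrange weights take O(N^2) in total. Each of the n interpolations may therefore cost
O(n^3) = O(N^(3/2)). Toom–Cook achieves this because log_3 5 < 3/2, that is, 25 < 27; Karatsuba's
exponent log_2 3 would be too large. -/

/-! ## Subresultant determinants of power series -/

section Subdet

open PowerSeries (coeff)

variable {R : Type*} [CommRing R]

/-- The rows are the coefficients of `f, X f, …, X ^ (a - 1) f` and `X ^ (N - 1 - a) g, …, X g, g`. -/
noncomputable def subdetMatrix (N a : ℕ) (f g : PowerSeries R) : Matrix (Fin N) (Fin N) R :=
  Matrix.of fun i j => coeff (j : ℕ)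
    (if (i : ℕ) < a then PowerSeries.X ^ (i : ℕ) * f else PowerSeries.X ^ (N - 1 - i) * g)

noncomputable def subdet (N a : ℕ) (f g : PowerSeries R) : R := (subdetMatrix N a f g).det

/-- The sign of the reversal of `n` elements. -/
def revSign (R : Type*) [CommRing R] (n : ℕ) : R := (-1) ^ (n * (n - 1) / 2)

lemma revSign_succ (n : ℕ) : revSign R (n + 1) = (-1) ^ n * revSign R n := by
  unfold revSign
  rw [← pow_add]
  congr 1
  have h : (n + 1) * (n + 1 - 1) = n * (n - 1) + n * 2 := by
    cases n with
    | zero => rfl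
    | succ k => simp only [Nat.add_sub_cancel]; ring
  rw [h, Nat.add_mul_div_right _ _ (by norm_num), add_comm]

lemma det_reversal (n : ℕ) :
    (Matrix.of fun i j : Fin n => if (i : ℕ) + j + 1 = n then (1 : R) else 0).det
      = revSign R n := by
  induction n with
  | zero => simp [revSign]
  | succ n ih =>
    rw [Matrix.det_succ_column_zero, Finset.sum_eq_single (Fin.last n), revSign_succ, ← ih]
    · simp only [Fin.val_last, Matrix.of_apply, Fin.val_zero, add_zero, if_true, mul_one]
      congr 2
      ext i j
      simp only [Matrix.submatrix_apply, Matrix.of_apply, Fin.succAbove_last, Fin.val_castSucc,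
        Fin.val_succ]
      congr 1
      simp only [eq_iff_iff]
      omega
    · intro i _ hi
      have : (i : ℕ) ≠ n := fun h => hi (Fin.ext h)
      simp [this]
    · simp

/-- Reversing the order of the rows exchanges the roles of the two blocks, because their shifts run
in opposite directions. -/
lemma subdet_swap {N a : ℕ} (ha : a ≤ N) (f g : PowerSeries R) :
    subdet N a f g = revSign R N * subdet N (N - a) g f := by
  rw [← det_reversal, subdet, subdet, ← Matrix.det_mul]
  congr 1
  ext i j
  rw [Matrix.mul_apply, Finset.sum_eq_single i.rev]
  · have h : (i : ℕ) + (i.rev : ℕ) + 1 = N := by rw [Fin.val_rev]; omega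
    have hi := i.2
    rw [Matrix.of_apply, if_pos h, one_mul]
    simp only [subdetMatrix, Matrix.of_apply, Fin.val_rev]
    by_cases hia : (i : ℕ) < a
    · rw [if_pos hia, if_neg (by omega)]
      congr 3
      omega
    · rw [if_neg hia, if_pos (by omega)]
      congr 3
      omega
  · intro k _ hk
    have : ¬ ((i : ℕ) + k + 1 = N) := fun h => hk (Fin.ext (by rw [Fin.val_rev]; omega))
    simp [this]
  · simp

lemma subdet_self (N : ℕ) (f g : PowerSeries R) : subdet N N f g = coeff 0 f ^ N := by
  have h : (subdetMatrix N N f g).BlockTriangular id := by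
    intro i j hij
    have : (j : ℕ) < i := hij
    simp only [subdetMatrix, Matrix.of_apply, if_pos i.2, PowerSeries.coeff_X_pow_mul']
    rw [if_neg (by omega)]
  rw [subdet, Matrix.det_of_isUpperTriangular h]
  simp [subdetMatrix, PowerSeries.coeff_X_pow_mul']

lemma subdet_zero (N : ℕ) (f g : PowerSeries R) :
    subdet N 0 f g = revSign R N * coeff 0 g ^ N := by
  rw [subdet_swap (Nat.zero_le N), Nat.sub_zero, subdet_self]

/-- Multiplication by u is right multiplication by an upper triangular Toeplitz matrix with u(0) on
the diagonal. -/
lemma subdet_mul (N a : ℕ) (f g u : PowerSeries R) :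
    subdet N a (f * u) (g * u) = coeff 0 u ^ N * subdet N a f g := by
  have hT : (Matrix.of fun i j : Fin N => coeff (j : ℕ) (PowerSeries.X ^ (i : ℕ) * u)).det
      = coeff 0 u ^ N := by
    rw [← subdet_self N u u, subdet]
    congr 1
    ext i j
    simp [subdetMatrix]
  rw [← hT, mul_comm (Matrix.det _), subdet, subdet, ← Matrix.det_mul]
  congr 1
  ext i j
  -- Since j < N, only the first N coefficients of w enter, so the truncation loses nothing.
  have key : ∀ w : PowerSeries R, coeff (j : ℕ) (w * u)
      = ∑ k : Fin N, coeff (k : ℕ) w * coeff (j : ℕ) (PowerSeries.X ^ (k : ℕ) * u) := by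
    intro w
    rw [PowerSeries.coeff_mul, Finset.Nat.sum_antidiagonal_eq_sum_range_succ
      (fun x y => coeff x w * coeff y u),
      Fin.sum_univ_eq_sum_range (fun k => coeff k w * coeff (j : ℕ) (PowerSeries.X ^ k * u)) N]
    have hj := j.2
    rw [← Finset.sum_subset (Finset.range_subset_range.2 (show (j : ℕ).succ ≤ N by omega))]
    · refine Finset.sum_congr rfl fun k hk => ?_
      rw [PowerSeries.coeff_X_pow_mul', if_pos (by simpa [Nat.lt_succ_iff] using hk)]
    · intro k _ hk
      rw [PowerSeries.coeff_X_pow_mul', if_neg (by simpa [Nat.lt_succ_iff] using hk), mul_zero]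
  rw [Matrix.mul_apply]
  simp only [subdetMatrix, Matrix.of_apply]
  rw [← key]
  split_ifs <;> rw [mul_assoc]

/-- A simultaneous row operation: for i < a the series X^(i+e) g is itself a row, at index
N-1-(i+e). The inequality places that row in the second block, hence below row i, which makes `L`
unitriangular. -/
lemma subdet_sub_mul {N a e : ℕ} (h : a + a + e ≤ N) (x : R) (f g : PowerSeries R) :
    subdet N a (f - PowerSeries.C x * (PowerSeries.X ^ e * g)) g = subdet N a f g := by
  let L : Matrix (Fin N) (Fin N) R := Matrix.of fun i k =>
    (if i = k then 1 else 0) + if (i : ℕ) < a ∧ (i : ℕ) + e + k + 1 = N then -x else 0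
  have hL : L.det = 1 := by
    rw [Matrix.det_of_isUpperTriangular (M := L)]
    · refine Finset.prod_eq_one fun i _ => ?_
      have : ¬ ((i : ℕ) < a ∧ (i : ℕ) + e + i + 1 = N) := by omega
      simp only [L, Matrix.of_apply, if_neg this]
      simp
    · intro i j hij
      have hij' : (j : ℕ) < i := hij
      have h1 : ¬ ((i : ℕ) < a ∧ (i : ℕ) + e + j + 1 = N) := by omega
      have h2 : i ≠ j := fun h => by omega
      simp [L, h1, h2]
  rw [subdet, subdet, ← one_mul (subdetMatrix N a f g).det, ← hL, ← Matrix.det_mul]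
  congr 1
  ext i j
  rw [Matrix.mul_apply]
  simp only [L, Matrix.of_apply, add_mul, Finset.sum_add_distrib, ite_mul, one_mul, zero_mul,
    Finset.sum_ite_eq, Finset.mem_univ, if_true]
  by_cases hi : (i : ℕ) < a
  · rw [Finset.sum_eq_single (⟨N - 1 - (i + e), by omega⟩ : Fin N)]
    · have h1 : (i : ℕ) < a ∧ (i : ℕ) + e + (N - 1 - (i + e)) + 1 = N := by omega
      simp only [if_pos h1]
      simp only [subdetMatrix, Matrix.of_apply, if_pos hi]
      rw [if_neg (by omega)]
      have h2 : N - 1 - (N - 1 - ((i : ℕ) + e)) = i + e := by omega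
      rw [h2, mul_sub, map_sub, pow_add]
      have h3 : PowerSeries.X ^ (i : ℕ) * (PowerSeries.C x * (PowerSeries.X ^ e * g))
        = PowerSeries.C x * (PowerSeries.X ^ (i : ℕ) * PowerSeries.X ^ e * g) := by ring
      rw [h3, PowerSeries.coeff_C_mul]
      ring
    · intro k _ hk
      rw [if_neg]
      rintro ⟨-, h1⟩
      exact hk (Fin.ext (by simp only; omega))
    · simp
  · simp [hi, subdetMatrix]

/-- Only the unshifted row g has a nonzero entry in column 0, so the determinant is expanded along
that column. -/
lemma subdet_X_mul (N b : ℕ) (f g : PowerSeries R) :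
    subdet (N + 1) (b + 1) g (PowerSeries.X * f) = coeff 0 g * subdet N b g f := by
  rw [subdet, Matrix.det_succ_column_zero, Finset.sum_eq_single 0]
  · have h : (subdetMatrix (N + 1) (b + 1) g (PowerSeries.X * f)).submatrix
        (Fin.succAbove 0) Fin.succ = subdetMatrix N b g f := by
      ext i j
      simp only [subdetMatrix, Matrix.submatrix_apply, Matrix.of_apply, Fin.succAbove_zero,
        Fin.val_succ, Nat.add_lt_add_iff_right]
      split_ifs
      · rw [pow_succ', mul_assoc, PowerSeries.coeff_succ_X_mul]
      · rw [mul_left_comm, PowerSeries.coeff_succ_X_mul]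
        congr 3
        omega
    rw [h]
    simp [subdetMatrix, subdet]
  · intro i _ hi
    have : (i : ℕ) ≠ 0 := fun h => hi (Fin.ext h)
    have h0 : subdetMatrix (N + 1) (b + 1) g (PowerSeries.X * f) i 0 = 0 := by
      simp only [subdetMatrix, Matrix.of_apply, Fin.val_zero]
      split_ifs
      · simp [this]
      · simp
    rw [h0]
    ring
  · simp

lemma subdet_X_pow_mul (N b e : ℕ) (f g : PowerSeries R) :
    subdet (N + e) (b + e) g (PowerSeries.X ^ e * f) = coeff 0 g ^ e * subdet N b g f := by
  induction e with
  | zero => simp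
  | succ e ih =>
    rw [← add_assoc, ← add_assoc, pow_succ', mul_assoc, subdet_X_mul, ih, pow_succ']
    ring

/-- After all b rows of g are expanded away, the rows that remain are still divisible by X, so a
column vanishes. This is the vanishing of subresultants in a degree gap. -/
lemma subdet_X_pow_mul_eq_zero {N b e : ℕ} (hb : b < N) (he : b < e) (f g : PowerSeries R) :
    subdet N b g (PowerSeries.X ^ e * f) = 0 := by
  obtain ⟨e', rfl⟩ : ∃ e', e = (e' + 1) + b := ⟨e - b - 1, by omega⟩
  obtain ⟨M, rfl⟩ : ∃ M, N = (M + 1) + b := ⟨N - b - 1, by omega⟩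
  have := subdet_X_pow_mul (M + 1) 0 b (PowerSeries.X ^ (e' + 1) * f) g
  rw [zero_add] at this
  rw [pow_add, mul_comm (PowerSeries.X ^ (e' + 1)), mul_assoc, this, subdet_zero]
  simp

lemma subdet_neg {N a : ℕ} (ha : a ≤ N) (f g : PowerSeries R) :
    subdet N a f (-g) = (-1) ^ (N - a) * subdet N a f g := by
  have h : ∏ i : Fin N, (if (i : ℕ) < a then (1 : R) else -1) = (-1) ^ (N - a) := by
    rw [Fin.prod_univ_eq_prod_range (fun i => if i < a then (1 : R) else -1) N]
    obtain ⟨b, rfl⟩ := Nat.exists_eq_add_of_le ha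
    rw [Finset.prod_range_add, Finset.prod_eq_one, one_mul]
    · simp
    · intro i hi
      rw [if_pos (Finset.mem_range.1 hi)]
  rw [← h, subdet, subdet, ← Matrix.det_mul_column]
  congr 1
  ext i j
  simp only [subdetMatrix, Matrix.of_apply]
  split_ifs <;> simp

/-- Used twice: to pass from ℝ to ℂ, where the roots live, and to specialise one matrix over ℝ[γ] at
each γ. -/
lemma subdet_map {S : Type*} [CommRing S] (φ : R →+* S) (N a : ℕ) (f g : PowerSeries R) :
    φ (subdet N a f g) = subdet N a (PowerSeries.map φ f) (PowerSeries.map φ g) := by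
  rw [subdet, RingHom.map_det, subdet]
  congr 1
  ext i j
  simp only [subdetMatrix, RingHom.mapMatrix_apply, Matrix.map_apply, Matrix.of_apply]
  split_ifs <;> rw [PowerSeries.coeff_X_pow_mul', PowerSeries.coeff_X_pow_mul'] <;>
    split_ifs <;> simp

/-- One step of the signed Euclidean algorithm: `f = h g - X ^ e r` with `deg h ≤ δ < e`. -/
lemma subdet_remainder {a δ e : ℕ} {f g r : PowerSeries R} (hδ : δ < e) (h : R[X])
    (hdeg : h.natDegree ≤ δ) (hf : f = (h : PowerSeries R) * g - PowerSeries.X ^ e * r) :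
    subdet (a + a + δ) a f g =
      revSign R δ * subdet (a + a + δ) (a + δ) g (PowerSeries.X ^ e * r) := by
  -- The product h g is subtracted one monomial of h at a time; each exponent i ≤ δ meets the bound
  -- a + a + i ≤ a + a + δ required for the row operation.
  have h1 : ∀ s : Finset ℕ, (∀ i ∈ s, i ≤ δ) →
      subdet (a + a + δ) a (f - ∑ i ∈ s, PowerSeries.C (h.coeff i) * (PowerSeries.X ^ i * g)) g
        = subdet (a + a + δ) a f g := by
    intro s
    induction s using Finset.induction_on with
    | empty => simp
    | insert i s hi ih =>
      intro hs
      rw [Finset.sum_insert hi, add_comm (PowerSeries.C _ * _), ← sub_sub, subdet_sub_mul, ih]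
      · exact fun j hj => hs j (Finset.mem_insert_of_mem hj)
      · have := hs i (Finset.mem_insert_self _ _)
        omega
  have h2 : (h : PowerSeries R) * g = ∑ i ∈ Finset.range (δ + 1),
      PowerSeries.C (h.coeff i) * (PowerSeries.X ^ i * g) := by
    conv_lhs => rw [h.as_sum_range_C_mul_X_pow' (Nat.lt_succ_of_le hdeg)]
    rw [← Polynomial.coeToPowerSeries.ringHom_apply, map_sum, Finset.sum_mul]
    refine Finset.sum_congr rfl fun i _ => ?_
    rw [map_mul, map_pow]
    simp [mul_assoc]
  rw [← h1 (Finset.range (δ + 1)) (fun i hi => Nat.lt_succ_iff.1 (Finset.mem_range.1 hi)), ← h2, hf,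
    sub_right_comm, sub_self, zero_sub, subdet_swap (by omega)]
  have h3 : a + a + δ - a = a + δ := by omega
  rw [h3, subdet_neg (by omega), ← mul_assoc]
  congr 1
  have h4 : a + a + δ - (a + δ) = a := by omega
  rw [h4, revSign, revSign, ← pow_add]
  -- Reversing all rows and negating the a rows of the remainder give a sign that differs from
  -- `revSign δ` by an even exponent.
  have h5 : (a + a + δ) * (a + a + δ - 1) / 2 + a = δ * (δ - 1) / 2 + 2 * (a * a + a * δ) := by
    have : (a + a + δ) * (a + a + δ - 1) + a * 2 = δ * (δ - 1) + 2 * (a * a + a * δ) * 2 := by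
      zify
      rcases Nat.eq_zero_or_pos δ with rfl | hδ
      · rcases Nat.eq_zero_or_pos a with rfl | ha
        · simp
        · rw [Nat.cast_sub (by omega)]
          push_cast
          ring
      · rw [Nat.cast_sub (by omega), Nat.cast_sub (by omega)]
        push_cast
        ring
    rw [← Nat.add_mul_div_right _ _ two_pos, this, Nat.add_mul_div_right _ _ two_pos]
  rw [h5, pow_add, pow_mul]
  simp

end Subdet

/-! ## Subdiscriminants as subresultants -/

section CauchyBinet

open Matrix

variable {R : Type*} [CommRing R]

/-- The Cauchy–Binet formula. -/
lemma det_mul_eq_sum_powersetCard {k n : ℕ} (A : Matrix (Fin k) (Fin n) R)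
    (B : Matrix (Fin n) (Fin k) R) (F : Finset (Fin n) → R)
    (hF : ∀ S (h : S.card = k), F S = (A.submatrix id (S.orderEmbOfFin h)).det *
      (B.submatrix (S.orderEmbOfFin h) id).det) :
    (A * B).det = ∑ S ∈ (Finset.univ : Finset (Fin n)).powersetCard k, F S := by
  classical
  have h1 : (A * B).det = ∑ r : Fin k → Fin n, (∏ i, A i (r i)) * (B.submatrix r id).det := by
    have : A * B = fun i => ∑ j, A i j • B j := by
      ext i c
      simp [Matrix.mul_apply, Finset.sum_apply]
    rw [this]
    change Matrix.detRowAlternating.toMultilinearMap _ = _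
    rw [MultilinearMap.map_sum]
    refine Finset.sum_congr rfl fun r _ => ?_
    rw [MultilinearMap.map_smul_univ]
    rfl
  -- A non-injective choice of rows repeats a row of B and contributes 0. The injective ones are
  -- grouped by their image S, and those with image S are the permutations followed by the
  -- increasing enumeration of S.
  rw [h1, ← Finset.sum_filter_of_ne (p := Function.Injective)]
  · rw [← Finset.sum_fiberwise_of_maps_to (g := fun r : Fin k → Fin n => Finset.univ.image r)
      (t := (Finset.univ : Finset (Fin n)).powersetCard k)]
    · refine Finset.sum_congr rfl fun S hS => ?_
      have hcard := (Finset.mem_powersetCard.1 hS).2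
      let e := S.orderEmbOfFin hcard
      have hinj : Function.Injective e := e.injective
      have himg : Finset.univ.image e = S := S.image_orderEmbOfFin_univ hcard
      rw [hF S hcard, ← Matrix.det_transpose, Matrix.det_apply', Finset.sum_mul]
      symm
      refine Finset.sum_bij (fun (σ : Equiv.Perm (Fin k)) _ => e ∘ σ) ?_ ?_ ?_ ?_
      · intro σ _
        simp only [Finset.mem_filter, Finset.mem_univ, true_and]
        refine ⟨hinj.comp σ.injective, ?_⟩
        rw [← Finset.image_image, Finset.image_univ_equiv, himg]
      · intro σ _ τ _ h
        ext i
        have := congrFun h i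
        exact congrArg Fin.val (hinj this)
      · intro r hr
        simp only [Finset.mem_filter, Finset.mem_univ, true_and] at hr
        have hex : ∀ i, ∃ j, e j = r i := by
          intro i
          have : r i ∈ Finset.univ.image e := by
            rw [himg, ← hr.2]
            exact Finset.mem_image_of_mem _ (Finset.mem_univ _)
          simpa using this
        choose σ hσ using hex
        have hσi : Function.Injective σ := fun i j hij => hr.1 (by rw [← hσ, ← hσ, hij])
        refine ⟨Equiv.ofBijective σ (Finite.injective_iff_bijective.1 hσi), Finset.mem_univ _, ?_⟩
        ext i
        simp [hσ]
      · intro σ _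
        have : B.submatrix (e ∘ σ) id = (B.submatrix e id).submatrix σ id := rfl
        rw [this, Matrix.det_permute]
        simp only [Matrix.transpose_apply, Matrix.submatrix_apply, id, Function.comp]
        ring
    · intro r hr
      rw [Finset.mem_powersetCard]
      refine ⟨Finset.subset_univ _, ?_⟩
      rw [Finset.card_image_of_injective _ (Finset.mem_filter.1 hr).2, Finset.card_univ,
        Fintype.card_fin]
  · intro r _ hne
    by_contra hr
    rw [Function.not_injective_iff] at hr
    obtain ⟨i, j, hij, hne'⟩ := hr
    refine hne ?_
    rw [Matrix.det_zero_of_row_eq hne' (by ext c; simp [hij]), mul_zero]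

lemma det_powerSums_eq_sum_powersetCard (k n : ℕ) (x : Fin n → R) :
    (Matrix.of fun r c : Fin k => ∑ i, x i ^ ((r : ℕ) + c)).det
      = ∑ S ∈ (Finset.univ : Finset (Fin n)).powersetCard k,
          ∏ i ∈ S, ∏ j ∈ S with i < j, (x i - x j) ^ 2 := by
  have h : (Matrix.of fun r c : Fin k => ∑ i, x i ^ ((r : ℕ) + c))
      = (Matrix.of fun (r : Fin k) i => x i ^ (r : ℕ)) * Matrix.of fun i (c : Fin k) => x i ^ (c : ℕ) := by
    ext r c
    simp [Matrix.mul_apply, pow_add]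
  rw [h]
  refine det_mul_eq_sum_powersetCard _ _ _ fun S hS => ?_
  have h1 : (Matrix.of fun i (c : Fin k) => x i ^ (c : ℕ)).submatrix (S.orderEmbOfFin hS) id
      = Matrix.vandermonde (fun i => x (S.orderEmbOfFin hS i)) := rfl
  have h2 : (Matrix.of fun (r : Fin k) i => x i ^ (r : ℕ)).submatrix id (S.orderEmbOfFin hS)
      = (Matrix.vandermonde (fun i => x (S.orderEmbOfFin hS i)))ᵀ := rfl
  rw [h1, h2, Matrix.det_transpose, Matrix.det_vandermonde, ← Finset.prod_mul_distrib]
  have himg : Finset.univ.map (S.orderEmbOfFin hS).toEmbedding = S := S.map_orderEmbOfFin_univ hS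
  conv_lhs => rw [← himg]
  rw [Finset.prod_map]
  refine Finset.prod_congr rfl fun i _ => ?_
  rw [Finset.filter_map, Finset.prod_map, ← Finset.prod_mul_distrib]
  have h3 : (Finset.univ.filter ((fun j => (S.orderEmbOfFin hS).toEmbedding i < j) ∘
      (S.orderEmbOfFin hS).toEmbedding)) = Finset.Ioi i := by
    ext j
    simp
  rw [h3]
  refine Finset.prod_congr rfl fun j _ => ?_
  simp only [RelEmbedding.coe_toEmbedding]
  ring

end CauchyBinet

/-! ### Hankel determinants of power sums -/

section PowerSums

variable {R : Type*} [CommRing R]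

/-- With f = 1 the first k rows are unit vectors, so the matrix is block triangular with an identity
block. For b = k + 1 the descending shifts make the remaining block a Hankel matrix with no sign to
correct. -/
lemma subdet_one_left (k b : ℕ) (S : PowerSeries R) :
    subdet (k + b) k 1 S = (Matrix.of fun r c : Fin b =>
      PowerSeries.coeff (k + c) (PowerSeries.X ^ (b - 1 - r) * S)).det := by
  have h : (subdetMatrix (k + b) k 1 S).submatrix finSumFinEquiv finSumFinEquiv
      = Matrix.fromBlocks 1 0
        (Matrix.of fun (r : Fin b) (c : Fin k) =>
          PowerSeries.coeff c (PowerSeries.X ^ (b - 1 - r) * S))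
        (Matrix.of fun r c : Fin b =>
          PowerSeries.coeff (k + c) (PowerSeries.X ^ (b - 1 - r) * S)) := by
    have hs : ∀ r : ℕ, k + b - 1 - (k + r) = b - 1 - r := fun r => by omega
    ext i j
    rcases i with i | i <;> rcases j with j | j
    · simp [subdetMatrix, PowerSeries.coeff_X_pow, Matrix.one_apply, Fin.ext_iff, eq_comm]
    · have : k + (j : ℕ) ≠ i := by omega
      simp [subdetMatrix, PowerSeries.coeff_X_pow, this]
    · simp [subdetMatrix, hs]
    · simp [subdetMatrix, hs]
  rw [subdet, ← Matrix.det_submatrix_equiv_self finSumFinEquiv, h,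
    Matrix.det_fromBlocks_zero₁₂, Matrix.det_one, one_mul]

lemma subdet_one_left_powerSums {n : ℕ} (k : ℕ) (x : Fin n → R) :
    subdet (k + (k + 1)) k 1 (PowerSeries.mk fun m => ∑ i, x i ^ m)
      = ∑ S ∈ (Finset.univ : Finset (Fin n)).powersetCard (k + 1),
          ∏ i ∈ S, ∏ j ∈ S with i < j, (x i - x j) ^ 2 := by
  rw [subdet_one_left, ← det_powerSums_eq_sum_powersetCard]
  congr 1
  ext r c
  have h1 : k + 1 - 1 - (r : ℕ) ≤ k + c := by omega
  have h2 : k + (c : ℕ) - (k + 1 - 1 - r) = r + c := by omega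
  simp only [Matrix.of_apply]
  rw [PowerSeries.coeff_X_pow_mul', if_pos h1, PowerSeries.coeff_mk, h2]

lemma one_sub_mul_mk_pow (x : R) :
    (1 - PowerSeries.C x * PowerSeries.X) * PowerSeries.mk (fun n => x ^ n) = 1 := by
  ext n
  rw [sub_mul, one_mul, mul_assoc, map_sub, PowerSeries.coeff_C_mul]
  cases n with
  | zero => simp
  | succ n =>
    rw [PowerSeries.coeff_succ_X_mul]
    simp [PowerSeries.coeff_one, pow_succ']

/-- The logarithmic derivative of `∏ (X - x)`, with all coefficients reversed. -/
lemma reflect_derivative_prod_X_sub_C [Nontrivial R] (l : List R) :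
    (((l.map fun x => X - C x).prod.derivative.reflect (l.length - 1) : R[X]) : PowerSeries R)
      = (((l.map fun x => X - C x).prod.reflect l.length : R[X]) : PowerSeries R)
        * PowerSeries.mk fun m => (l.map fun x => x ^ m).sum := by
  induction l with
  | nil => ext; simp
  | cons x l ih =>
    set P := (l.map fun x => X - C x).prod with hP
    have hdeg : P.natDegree = l.length := by
      have := natDegree_multiset_prod_X_sub_C_eq_card (l : Multiset R)
      simpa using this
    have hx : (X - C x : R[X]).natDegree ≤ 1 := natDegree_X_sub_C_le x
    have hr : (X - C x : R[X]).reflect 1 = 1 - C x * X := by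
      rw [reflect_sub, reflect_one_X, reflect_C, pow_one]
    have h1 : ((X - C x) * P).reflect (l.length + 1) = (1 - C x * X) * P.reflect l.length := by
      rw [add_comm, reflect_mul _ _ hx hdeg.le, hr]
    have h2 : ((X - C x) * P).derivative.reflect l.length
        = P.reflect l.length + (1 - C x * X) * P.derivative.reflect (l.length - 1) := by
      rw [derivative_mul, derivative_X_sub_C, one_mul, reflect_add]
      -- For the empty list the truncated `l.length - 1` does not split as needed below, but there P
      -- = 1 has derivative 0.
      rcases Nat.eq_zero_or_pos l.length with h0 | h0
      · have : P = 1 := by rw [hP, List.length_eq_zero_iff.1 h0]; simp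
        simp [this]
      · congr 1
        have h3 : l.length = 1 + (l.length - 1) := by omega
        conv_lhs => rw [h3]
        rw [reflect_mul _ _ hx ((natDegree_derivative_le P).trans (by omega)), hr]
    have h4 : (PowerSeries.mk fun m => ((x :: l).map fun x => x ^ m).sum)
        = PowerSeries.mk (fun m => x ^ m) + PowerSeries.mk fun m => (l.map fun x => x ^ m).sum := by
      ext m
      simp
    rw [List.map_cons, List.prod_cons, List.length_cons, Nat.add_sub_cancel, ← hP, h1, h2, h4]
    have h5 := one_sub_mul_mk_pow x
    push_cast at ih ⊢
    rw [ih]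
    linear_combination (-(P.reflect l.length : PowerSeries R)) * h5

end PowerSums

/-! ### Subresultants of p and p' in terms of the roots -/

lemma shiftedRow_eq_coeff {f : ℝ[X]} {e : ℕ} (hf : f.natDegree ≤ e) (s j : ℕ) :
    shiftedRow f e s j =
      PowerSeries.coeff j (PowerSeries.X ^ s * ((f.reflect e : ℝ[X]) : PowerSeries ℝ)) := by
  rw [PowerSeries.coeff_X_pow_mul', shiftedRow, Polynomial.coeff_coe, coeff_reflect]
  by_cases h : s ≤ j
  · rw [if_pos h]
    by_cases h' : j ≤ e + s
    · rw [if_pos ⟨h, h'⟩, revAt_le (by omega)]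
      congr 1
      omega
    · rw [if_neg (fun h => h' h.2), revAt_eq_self_of_lt (by omega), coeff_eq_zero_of_natDegree_lt]
      omega
  · rw [if_neg h, if_neg (fun h' => h h'.1)]

lemma sRes_eq_subdet (k : ℕ) (p : ℝ[X]) :
    sRes k p = subdet (2 * p.natDegree - 1 - 2 * k) (p.natDegree - 1 - k)
      ((p.reflect p.natDegree : ℝ[X]) : PowerSeries ℝ)
      ((p.derivative.reflect (p.natDegree - 1) : ℝ[X]) : PowerSeries ℝ) := by
  simp only [sRes, subdet]
  congr 1
  ext i j
  simp only [Matrix.of_apply, subdetMatrix]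
  rw [shiftedRow_eq_coeff le_rfl, shiftedRow_eq_coeff (natDegree_derivative_le p),
    show 2 * p.natDegree - 1 - 2 * k - 1 - (i : ℕ) = 2 * p.natDegree - 2 - 2 * k - i by omega]
  split_ifs <;> rfl

/-- The matrix has size 2k+1, so removing the common factor reversed p yields a_N^(2k+1); the
normalisation of sDisc_(k+1) absorbs a_N^(2k), and one factor a_N is left. -/
theorem sRes_eq_leadingCoeff_mul_sDisc {k : ℕ} {p : ℝ[X]} (hk : k < p.natDegree) :
    ((sRes (p.natDegree - (k + 1)) p : ℝ) : ℂ) = (p.leadingCoeff : ℂ) * sDisc (k + 1) p := by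
  set P : ℂ[X] := p.map (algebraMap ℝ ℂ) with hP
  set l : List ℂ := P.roots.toList with hl
  have hdeg : P.natDegree = p.natDegree := natDegree_map _
  have hlen : l.length = p.natDegree := by
    rw [hl, Multiset.length_toList, ← hdeg]
    exact (splits_iff_card_roots.1 (IsAlgClosed.splits P))
  have hlead : P.leadingCoeff = (p.leadingCoeff : ℂ) := leadingCoeff_map _
  have hprod : P = C (p.leadingCoeff : ℂ) * (l.map fun x => X - C x).prod := by
    have h := C_leadingCoeff_mul_prod_multiset_X_sub_C
      (splits_iff_card_roots.1 (IsAlgClosed.splits P))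
    rw [← h, hlead, hl]
    congr 1
    conv_lhs => rw [← Multiset.coe_toList P.roots]
    rw [Multiset.map_coe, Multiset.prod_coe]
  have hder : ((P.derivative.reflect (p.natDegree - 1) : ℂ[X]) : PowerSeries ℂ)
      = (PowerSeries.mk fun m => ∑ i, l.get i ^ m)
        * ((P.reflect p.natDegree : ℂ[X]) : PowerSeries ℂ) := by
    have h := reflect_derivative_prod_X_sub_C l
    have hs : ∀ m, (l.map fun x => x ^ m).sum = ∑ i, l.get i ^ m := by
      intro m
      exact (Fin.sum_univ_fun_getElem l fun x => x ^ m).symm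
    simp only [hs] at h
    rw [hprod, derivative_C_mul, reflect_C_mul, reflect_C_mul, ← hlen]
    push_cast
    rw [h]
    ring
  have h0 : PowerSeries.coeff 0 ((P.reflect p.natDegree : ℂ[X]) : PowerSeries ℂ)
      = (p.leadingCoeff : ℂ) := by
    rw [Polynomial.coeff_coe, coeff_reflect, revAt_le (Nat.zero_le _), Nat.sub_zero, ← hdeg,
      ← hlead]
    rfl
  have hmap : ∀ (e : ℕ) (f : ℝ[X]), PowerSeries.map (algebraMap ℝ ℂ)
      ((f.reflect e : ℝ[X]) : PowerSeries ℝ)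
        = (((f.map (algebraMap ℝ ℂ)).reflect e : ℂ[X]) : PowerSeries ℂ) := by
    intro e f
    rw [← polynomial_map_coe, reflect_map]
  have hc : ∀ r : ℝ, (r : ℂ) = algebraMap ℝ ℂ r := fun _ => rfl
  rw [sRes_eq_subdet, hc (subdet _ _ _ _), subdet_map, hmap, hmap, ← derivative_map, ← hP, hder]
  have h1 : 2 * p.natDegree - 1 - 2 * (p.natDegree - (k + 1)) = k + (k + 1) := by omega
  have h2 : p.natDegree - 1 - (p.natDegree - (k + 1)) = k := by omega
  rw [h1, h2]
  have hm := subdet_mul (k + (k + 1)) k 1 (PowerSeries.mk fun m => ∑ i, l.get i ^ m)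
    ((P.reflect p.natDegree : ℂ[X]) : PowerSeries ℂ)
  rw [one_mul] at hm
  rw [hm, subdet_one_left_powerSums, h0, sDisc, ← mul_assoc]
  congr 1
  -- The integer exponent in `sDisc` is nonnegative here, so it becomes an ordinary power.
  have h3 : (2 * ((k + 1 : ℕ) : ℤ) - 2) = ((2 * k : ℕ) : ℤ) := by push_cast; ring
  rw [h3, zpow_natCast, ← pow_succ']
  congr 1
  ring

lemma sDisc_eq_zero {k : ℕ} {p : ℝ[X]} (hk : p.natDegree < k) : sDisc k p = 0 := by
  have h : (p.map (algebraMap ℝ ℂ)).roots.toList.length < k := by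
    rw [Multiset.length_toList]
    exact ((card_roots' _).trans natDegree_map_le).trans_lt hk
  simp only [sDisc]
  rw [Finset.powersetCard_eq_empty.2 (by simpa using h), Finset.sum_empty, mul_zero]

/-! ## Correctness and cost of programs -/

namespace Prog

section Runs

variable {α β : Type}

/-- The program runs in at most `T` steps without dividing by zero, and its result satisfies `Q`. -/
def Runs (P : Prog ℝ α) (T : ℕ) (Q : α → Prop) : Prop :=
  ∃ a t, P.run = some (a, t) ∧ t ≤ T ∧ Q a

lemma run_seq (P : Prog ℝ α) (f : α → Prog ℝ β) :
    (P.seq f).run = P.run.bind fun r => (f r.1).run.map fun r' => (r'.1, r'.2 + r.2) := by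
  induction P with
  | ret a => simp [seq, run]
  | const z next ih =>
    simp only [seq, run, ih]
    cases (next z).run <;> simp [Function.comp_def, add_assoc]
  | arith o x y next ih =>
    have key : ∀ v, ((next v).seq f).run.map (fun r => (r.1, r.2 + 1))
        = ((next v).run.map fun r => (r.1, r.2 + 1)).bind
            fun r => (f r.1).run.map fun r' => (r'.1, r'.2 + r.2) := by
      intro v
      rw [ih]
      cases (next v).run <;> simp [Function.comp_def, add_assoc]
    cases o
    · exact key _
    · exact key _
    · exact key _
    · simp only [seq, run]
      split_ifs
      · rfl
      · exact key _
  | test x next ih =>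
    simp only [seq, run, ih]
    cases (next (decide (x = 0))).run <;> simp [Function.comp_def, add_assoc]

/-- The sequencing rule of a Hoare logic with costs. Nested applications follow a program
instruction by instruction, which leaves one arithmetic inequality for the total cost. -/
lemma Runs.bind {P : Prog ℝ α} {f : α → Prog ℝ β} {T₁ T₂ : ℕ} {Q : α → Prop} {Q' : β → Prop}
    (hP : Runs P T₁ Q) (hf : ∀ a, Q a → Runs (f a) T₂ Q') : Runs (P >>= f) (T₁ + T₂) Q' := by
  obtain ⟨a, t, h1, h2, h3⟩ := hP
  obtain ⟨b, t', h4, h5, h6⟩ := hf a h3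
  refine ⟨b, t' + t, ?_, by omega, h6⟩
  change (P.seq f).run = _
  rw [run_seq, h1]
  simp [h4]

lemma Runs.pure {a : α} {Q : α → Prop} (h : Q a) : Runs (pure a) 0 Q :=
  ⟨a, 0, rfl, le_rfl, h⟩

lemma Runs.mono {P : Prog ℝ α} {T T' : ℕ} {Q Q' : α → Prop} (h : Runs P T Q) (hT : T ≤ T')
    (hQ : ∀ a, Q a → Q' a) : Runs P T' Q' := by
  obtain ⟨a, t, h1, h2, h3⟩ := h
  exact ⟨a, t, h1, h2.trans hT, hQ a h3⟩

lemma Runs.le {P : Prog ℝ α} {T T' : ℕ} {Q : α → Prop} (h : Runs P T Q) (hT : T ≤ T') :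
    Runs P T' Q :=
  h.mono hT fun _ h => h

lemma runs_int (z : ℤ) : Runs (int z) 1 (· = (z : ℝ)) := ⟨z, 1, rfl, le_rfl, rfl⟩

lemma runs_add (x y : ℝ) : Runs (add x y) 1 (· = x + y) := ⟨_, 1, rfl, le_rfl, rfl⟩

lemma runs_sub (x y : ℝ) : Runs (sub x y) 1 (· = x - y) := ⟨_, 1, rfl, le_rfl, rfl⟩

lemma runs_mul (x y : ℝ) : Runs (mul x y) 1 (· = x * y) := ⟨_, 1, rfl, le_rfl, rfl⟩

lemma runs_div {x y : ℝ} (hy : y ≠ 0) : Runs (div x y) 1 (· = x / y) :=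
  ⟨x / y, 1, by simp [div, run, hy], le_rfl, rfl⟩

lemma runs_isZero (x : ℝ) : Runs (isZero x) 1 (fun b => b = true ↔ x = 0) :=
  ⟨decide (x = 0), 1, rfl, le_rfl, by simp⟩

lemma runs_mapList_forall₂ {f : α → Prog ℝ β} {T : ℕ} {Q : α → β → Prop} (l : List α)
    (h : ∀ a ∈ l, Runs (f a) T (Q a)) : Runs (mapList f l) (l.length * T) (List.Forall₂ Q l) := by
  induction l with
  | nil => exact (Runs.pure List.Forall₂.nil).le (Nat.zero_le _)
  | cons a l ih =>
    refine Runs.le (Runs.bind (h a (by simp)) fun b hb =>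
      Runs.bind (ih fun a ha => h a (by simp [ha])) fun bs hbs => Runs.pure (.cons hb hbs)) ?_
    rw [List.length_cons]
    linarith

lemma runs_mapList {f : α → Prog ℝ β} {T : ℕ} (g : α → β) (l : List α)
    (h : ∀ a ∈ l, Runs (f a) T (· = g a)) : Runs (mapList f l) (l.length * T) (· = l.map g) := by
  refine (runs_mapList_forall₂ l h).mono le_rfl fun bs hbs => ?_
  induction hbs with
  | nil => rfl
  | cons hb _ ih => rw [hb, List.map_cons, ih fun a ha => h a (by simp [ha])]

lemma runs_pow (x : ℝ) (e : ℕ) : Runs (pow x e) (e + 1) (· = x ^ e) := by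
  induction e with
  | zero => exact (runs_int 1).mono le_rfl (by simp)
  | succ e ih =>
    exact Runs.bind ih fun y hy => (runs_mul x y).mono le_rfl fun z hz => by
      rw [hz, hy, pow_succ']

lemma runs_zeros (l : ℕ) : Runs (zeros l : Prog ℝ (List ℝ)) 1 (· = List.replicate l (0 : ℝ)) :=
  Runs.bind (runs_int 0) fun z hz => Runs.pure (by simp [hz])

end Runs

/-! ### Coefficient lists -/

section Coeffs

lemma ofCoeffs_append (l h : List ℝ) :
    ofCoeffs (l ++ h) = ofCoeffs l + X ^ l.length * ofCoeffs h := by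
  induction l with
  | nil => simp [ofCoeffs]
  | cons a l ih =>
    simp only [List.cons_append, ofCoeffs, ih, List.length_cons]
    ring

lemma ofCoeffs_replicate_zero (n : ℕ) : ofCoeffs (List.replicate n 0) = 0 := by
  induction n with
  | zero => rfl
  | succ n ih => simp [List.replicate_succ, ofCoeffs, ih]

lemma ofCoeffs_map_mul (x : ℝ) (l : List ℝ) :
    ofCoeffs (l.map fun a => x * a) = C x * ofCoeffs l := by
  induction l with
  | nil => simp [ofCoeffs]
  | cons a l ih =>
    simp only [List.map_cons, ofCoeffs, ih, C_mul]
    ring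

lemma coeff_ofCoeffs (l : List ℝ) (i : ℕ) : (ofCoeffs l).coeff i = l.getD i 0 := by
  induction l generalizing i with
  | nil => simp [ofCoeffs]
  | cons a l ih =>
    cases i with
    | zero => simp [ofCoeffs]
    | succ i => simp [ofCoeffs, ih, coeff_C_succ]

lemma coeff_ofCoeffs_of_length_le {l : List ℝ} {i : ℕ} (h : l.length ≤ i) :
    (ofCoeffs l).coeff i = 0 := by
  rw [coeff_ofCoeffs, List.getD_eq_default _ _ h]

lemma ofCoeffs_take_add_drop (w : ℕ) (l : List ℝ) :
    ofCoeffs l = ofCoeffs (l.take w) + X ^ w * ofCoeffs (l.drop w) := by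
  rcases le_total w l.length with h | h
  · conv_lhs => rw [← List.take_append_drop w l]
    rw [ofCoeffs_append, List.length_take, min_eq_left h]
  · rw [List.take_of_length_le h, List.drop_of_length_le h]
    simp [ofCoeffs]

lemma ofCoeffs_take_of_coeff_eq_zero {l : List ℝ} {n : ℕ}
    (h : ∀ i, n ≤ i → (ofCoeffs l).coeff i = 0) : ofCoeffs (l.take n) = ofCoeffs l := by
  ext i
  rw [coeff_ofCoeffs]
  rcases lt_or_ge i n with hi | hi
  · rw [coeff_ofCoeffs, List.getD_eq_getElem?_getD, List.getD_eq_getElem?_getD,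
      List.getElem?_take_of_lt hi]
  · rw [h i hi, List.getD_eq_default]
    exact (List.length_take_le _ _).trans hi

/-- `l` lists at most `L` coefficients of the polynomial `p`. -/
def Represents (p : ℝ[X]) (L : ℕ) (l : List ℝ) : Prop := ofCoeffs l = p ∧ l.length ≤ L

lemma Represents.mono {p : ℝ[X]} {L M : ℕ} {l : List ℝ} (h : Represents p L l) (hL : L ≤ M) :
    Represents p M l :=
  ⟨h.1, h.2.trans hL⟩

/-- Addition stops at the end of the shorter list. Bounding the cost by the first list alone lets
`addShift` pay only for the low part and not for the long shifted one. -/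
lemma runs_addL_length (as bs : List ℝ) : Runs (addL as bs) as.length
    fun r => ofCoeffs r = ofCoeffs as + ofCoeffs bs ∧ r.length = max as.length bs.length := by
  induction as generalizing bs with
  | nil => exact (Runs.pure ⟨by simp [ofCoeffs], by simp⟩).le (Nat.zero_le _)
  | cons a as ih =>
    cases bs with
    | nil => exact (Runs.pure ⟨by simp [ofCoeffs], by simp⟩).le (Nat.zero_le _)
    | cons b bs =>
      refine Runs.le (Runs.bind (runs_add a b) fun s hs => Runs.bind (ih bs) fun r hr =>
        Runs.pure ⟨?_, ?_⟩) (T := 1 + (as.length + 0)) (by simp; omega)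
      · simp only [ofCoeffs, hs, hr.1, C_add]
        ring
      · simp only [List.length_cons, hr.2]
        omega

lemma runs_addL {p q : ℝ[X]} {L : ℕ} {as bs : List ℝ} (ha : Represents p L as)
    (hb : Represents q L bs) : Runs (addL as bs) L (Represents (p + q) L) :=
  (runs_addL_length as bs).mono ha.2 fun r hr =>
    ⟨by rw [hr.1, ha.1, hb.1], by rw [hr.2]; exact max_le ha.2 hb.2⟩

lemma runs_scaleL_list (x : ℝ) (l : List ℝ) :
    Runs (scaleL x l) l.length (· = l.map fun a => x * a) :=
  (runs_mapList _ l fun a _ => runs_mul x a).le (by simp)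

lemma runs_scaleL {p : ℝ[X]} {L : ℕ} {l : List ℝ} (x : ℝ) (h : Represents p L l) :
    Runs (scaleL x l) L (Represents (C x * p) L) :=
  (runs_scaleL_list x l).mono h.2 fun r hr => by
    subst hr
    exact ⟨by rw [ofCoeffs_map_mul, h.1], by simpa using h.2⟩

lemma runs_negL_list (l : List ℝ) :
    Runs (negL l) (1 + l.length) fun r => ofCoeffs r = -ofCoeffs l ∧ r.length = l.length := by
  refine Runs.bind (runs_int 0) fun z hz => ?_
  refine (runs_mapList (T := 1) (fun a => z - a) l fun a _ => runs_sub z a).mono (by simp) fun r hr => ?_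
  subst hr
  refine ⟨?_, by simp⟩
  have := ofCoeffs_map_mul (-1) l
  simp only [neg_mul, one_mul, map_neg, map_one] at this
  rw [← this, hz]
  simp only [Int.cast_zero, zero_sub]

lemma runs_subL {p q : ℝ[X]} {L : ℕ} {as bs : List ℝ} (ha : Represents p L as)
    (hb : Represents q L bs) : Runs (subL as bs) (1 + L + L) (Represents (p - q) L) := by
  refine Runs.bind ((runs_negL_list bs).le (Nat.add_le_add_left hb.2 1)) fun r hr => ?_
  rw [sub_eq_add_neg]
  exact runs_addL ha ⟨by rw [hr.1, hb.1], hr.2.trans_le hb.2⟩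

lemma runs_divL_list {x : ℝ} (hx : x ≠ 0) (l : List ℝ) :
    Runs (divL l x) l.length (· = l.map fun a => a / x) :=
  (runs_mapList _ l fun _ _ => runs_div hx).le (by simp)

/-- The quotient is prescribed through p = x q, so interpolation formulas can be checked by ring
identities without inverses. -/
lemma runs_divL {p q : ℝ[X]} {L : ℕ} {l : List ℝ} {x : ℝ} (hx : x ≠ 0) (h : Represents p L l)
    (hpq : p = C x * q) : Runs (divL l x) L (Represents q L) :=
  (runs_divL_list hx l).mono h.2 fun r hr => by
    subst hr
    refine ⟨?_, by simpa using h.2⟩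
    have h1 : (l.map fun a => a / x) = l.map fun a => x⁻¹ * a := by
      simp only [div_eq_inv_mul]
    rw [h1, ofCoeffs_map_mul, h.1, hpq, ← mul_assoc, ← C_mul, inv_mul_cancel₀ hx, C_1, one_mul]

lemma runs_addShift {p q : ℝ[X]} {b L M N : ℕ} {l h : List ℝ} (hl : Represents p L l)
    (hh : Represents q M h) (hLN : L ≤ N) (hMN : b + M ≤ N) :
    Runs (addShift b l h) (1 + L) (Represents (p + X ^ b * q) N) := by
  refine Runs.bind (runs_zeros b) fun z hz => ?_
  subst hz
  refine (runs_addL_length l _).mono hl.2 fun r hr => ⟨?_, ?_⟩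
  · rw [hr.1, ofCoeffs_append, ofCoeffs_replicate_zero, List.length_replicate, hl.1, hh.1, zero_add]
  · rw [hr.2, List.length_append, List.length_replicate]
    exact max_le (hl.2.trans hLN) ((Nat.add_le_add_left hh.2 b).trans hMN)

lemma runs_evalAt (l : List ℝ) (x : ℝ) :
    Runs (evalAt l x) (1 + 2 * l.length) (· = (ofCoeffs l).eval x) := by
  induction l with
  | nil => exact (runs_int 0).mono le_rfl (by simp [ofCoeffs])
  | cons a l ih =>
    refine Runs.le (Runs.bind ih fun v hv => Runs.bind (runs_mul x v) fun t ht =>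
      (runs_add a t).mono le_rfl fun r hr => ?_) (by simp; omega)
    simp [hr, ht, hv, ofCoeffs]

lemma runs_allZero (l : List ℝ) :
    Runs (allZero l) l.length fun b => b = true ↔ ∀ a ∈ l, a = 0 := by
  induction l with
  | nil => exact Runs.pure (by simp)
  | cons a l ih =>
    refine Runs.le (Runs.bind (T₂ := l.length) (runs_isZero a) fun z hz => ?_) (by simp; omega)
    cases z with
    | true => exact ih.mono le_rfl fun b hb => by simp [hb, hz.1 rfl]
    | false =>
      have : a ≠ 0 := fun h => by simpa using hz.2 h
      exact (Runs.pure (by simp [this])).le (Nat.zero_le _)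

end Coeffs

/-! ### Fast multiplication -/

section Multiplication

/-- Five recursive products; the linear operations around them are rounded up to 80 * 3 ^ k + 20. -/
def toomCookCost : ℕ → ℕ
  | 0 => 1
  | k + 1 => 5 * toomCookCost k + 80 * 3 ^ k + 20

lemma runs_toomCook (k : ℕ) : ∀ {p q : ℝ[X]} {as bs : List ℝ}, Represents p (3 ^ k) as →
    Represents q (3 ^ k) bs →
    Runs (toomCook k as bs) (toomCookCost k) (Represents (p * q) (2 * 3 ^ k)) := by
  induction k with
  | zero =>
    intro p q as bs ha hb
    obtain ⟨rfl, ha⟩ := ha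
    obtain ⟨rfl, hb⟩ := hb
    rcases as with _ | ⟨a, _ | _⟩ <;> rcases bs with _ | ⟨b, _ | _⟩ <;> try simp at ha hb
    · exact (Runs.pure ⟨by simp [ofCoeffs], by simp⟩).le (Nat.zero_le _)
    · exact (Runs.pure ⟨by simp [ofCoeffs], by simp⟩).le (Nat.zero_le _)
    · exact (Runs.pure ⟨by simp [ofCoeffs], by simp⟩).le (Nat.zero_le _)
    · exact Runs.bind (runs_mul a b) fun t ht => Runs.pure ⟨by simp [ofCoeffs, ht], by simp⟩
  | succ k ih =>
    intro p q as bs ha hb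
    obtain ⟨rfl, ha⟩ := ha
    obtain ⟨rfl, hb⟩ := hb
    rcases as with _ | ⟨a, as⟩
    · exact (Runs.pure ⟨by simp [ofCoeffs], by simp⟩).le (Nat.zero_le _)
    rcases bs with _ | ⟨b, bs⟩
    · exact (Runs.pure ⟨by simp [ofCoeffs], by simp⟩).le (Nat.zero_le _)
    simp only [toomCook]
    generalize a :: as = A at *
    generalize b :: bs = B at *
    have hw : 3 ^ (k + 1) = 3 * 3 ^ k := pow_succ' 3 k
    rw [hw] at ha hb ⊢
    obtain ⟨w, hwdef⟩ : ∃ w, w = 3 ^ k := ⟨_, rfl⟩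
    simp only [← hwdef] at ha hb ih ⊢
    have split : ∀ l : List ℝ, ofCoeffs l = ofCoeffs (l.take w) +
        X ^ w * (ofCoeffs ((l.drop w).take w) + X ^ w * ofCoeffs (l.drop (2 * w))) := by
      intro l
      rw [two_mul, ← List.drop_drop, ← ofCoeffs_take_add_drop, ← ofCoeffs_take_add_drop]
    rw [split A, split B]
    have r0 : ∀ l : List ℝ, Represents (ofCoeffs (l.take w)) w (l.take w) := fun l =>
      ⟨rfl, List.length_take_le _ _⟩
    have r2 : ∀ l : List ℝ, l.length ≤ 3 * w →
        Represents (ofCoeffs (l.drop (2 * w))) w (l.drop (2 * w)) := fun l hl =>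
      ⟨rfl, by rw [List.length_drop]; omega⟩
    have ra0 := r0 A
    have ra1 := r0 (A.drop w)
    have ra2 := r2 A ha
    have rb0 := r0 B
    have rb1 := r0 (B.drop w)
    have rb2 := r2 B hb
    generalize A.take w = A0 at *
    generalize (A.drop w).take w = A1 at *
    generalize A.drop (2 * w) = A2 at *
    generalize B.take w = B0 at *
    generalize (B.drop w).take w = B1 at *
    generalize B.drop (2 * w) = B2 at *
    generalize ofCoeffs A0 = a0 at *
    generalize ofCoeffs A1 = a1 at *
    generalize ofCoeffs A2 = a2 at *
    generalize ofCoeffs B0 = b0 at *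
    generalize ofCoeffs B1 = b1 at *
    generalize ofCoeffs B2 = b2 at *
    refine Runs.le (
      Runs.bind (runs_int 2) fun two h2 =>
      Runs.bind (runs_int 3) fun three h3 =>
      Runs.bind (runs_int 4) fun four h4 =>
      Runs.bind (runs_int 16) fun sixteen h16 =>
      have two_ne : two ≠ 0 := by rw [h2]; norm_num
      have three_ne : three ≠ 0 := by rw [h3]; norm_num
      have C2 : C two = 2 := by rw [h2, Int.cast_ofNat]; exact map_ofNat C 2
      have C3 : C three = 3 := by rw [h3, Int.cast_ofNat]; exact map_ofNat C 3
      have C4 : C four = 4 := by rw [h4, Int.cast_ofNat]; exact map_ofNat C 4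
      have C16 : C sixteen = 16 := by rw [h16, Int.cast_ofNat]; exact map_ofNat C 16
      Runs.bind (runs_addL ra0 ra2) fun _ rea =>
      Runs.bind (runs_addL rb0 rb2) fun _ reb =>
      Runs.bind (runs_addL rea ra1) fun _ rap =>
      Runs.bind (runs_addL reb rb1) fun _ rbp =>
      Runs.bind (runs_subL rea ra1) fun _ ram =>
      Runs.bind (runs_subL reb rb1) fun _ rbm =>
      Runs.bind (runs_scaleL _ ra1) fun _ ra1' =>
      Runs.bind (runs_scaleL _ ra2) fun _ ra2' =>
      Runs.bind (runs_scaleL _ rb1) fun _ rb1' =>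
      Runs.bind (runs_scaleL _ rb2) fun _ rb2' =>
      Runs.bind (runs_addL ra1' ra2') fun _ ra12 =>
      Runs.bind (runs_addL rb1' rb2') fun _ rb12 =>
      Runs.bind (runs_addL ra0 ra12) fun _ rat2 =>
      Runs.bind (runs_addL rb0 rb12) fun _ rbt2 =>
      Runs.bind (ih ra0 rb0) fun _ rc0 =>
      Runs.bind (ih rap rbp) fun _ rrp =>
      Runs.bind (ih ram rbm) fun _ rrm =>
      Runs.bind (ih rat2 rbt2) fun _ rrt =>
      Runs.bind (ih ra2 rb2) fun _ rc4 =>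
      -- Let cᵢ be the coefficients of (a0 + a1 Y + a2 Y²)(b0 + b1 Y + b2 Y²). The quotients
      -- prescribed below are c₀ + c₂ + c₄ and c₁ + c₃ from the values at ±1, then c₁ + 4c₃ from the
      -- value at 2; subtracting c₁ + c₃ leaves 3c₃.
      Runs.bind (runs_addL rrp rrm) fun _ ru =>
      Runs.bind (runs_divL (q := a0 * b0 + (a0 * b2 + a1 * b1 + a2 * b0) + a2 * b2)
        two_ne ru (by rw [C2]; ring)) fun _ ru =>
      Runs.bind (runs_subL ru rc0) fun _ ru =>
      Runs.bind (runs_subL ru rc4) fun _ rc2 =>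
      Runs.bind (runs_subL rrp rrm) fun _ rv =>
      Runs.bind (runs_divL (q := a0 * b1 + a1 * b0 + (a1 * b2 + a2 * b1))
        two_ne rv (by rw [C2]; ring)) fun _ rv =>
      Runs.bind (runs_subL rrt rc0) fun _ rt =>
      Runs.bind (runs_scaleL _ rc2) fun _ rc2' =>
      Runs.bind (runs_subL rt rc2') fun _ rt =>
      Runs.bind (runs_scaleL _ rc4) fun _ rc4' =>
      Runs.bind (runs_subL rt rc4') fun _ rt =>
      Runs.bind (runs_divL (q := a0 * b1 + a1 * b0 + 4 * (a1 * b2 + a2 * b1))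
        two_ne rt (by rw [C2, C4, C16]; ring)) fun _ rt =>
      Runs.bind (runs_subL rt rv) fun _ rt =>
      Runs.bind (runs_divL (q := a1 * b2 + a2 * b1)
        three_ne rt (by rw [C3]; ring)) fun _ rc3 =>
      Runs.bind (runs_subL rv rc3) fun _ rc1 =>
      Runs.bind (runs_addShift (N := 3 * w) rc3 rc4 (by omega) (by omega)) fun _ rh =>
      Runs.bind (runs_addShift (N := 4 * w) rc2 rh (by omega) (by omega)) fun _ rh =>
      Runs.bind (runs_addShift (N := 5 * w) rc1 rh (by omega) (by omega)) fun _ rh =>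
      (runs_addShift (N := 2 * (3 * w)) rc0 rh (by omega) (by omega)).mono le_rfl
        fun r hr => by convert hr using 1; ring) ?_
    rw [toomCookCost, ← hwdef]
    generalize toomCookCost k = T
    linarith

end Multiplication

end Prog

namespace Prog

section Multiplication

/-- The added terms make the recursion homogeneous: the left side is multiplied by exactly 5 at each
step, starting from 46 = 1 + 40 + 5. -/
lemma toomCookCost_le (k : ℕ) : toomCookCost k + 40 * 3 ^ k + 5 ≤ 46 * 5 ^ k := by
  induction k with
  | zero => simp [toomCookCost]
  | succ k ih =>
    rw [toomCookCost, pow_succ, pow_succ]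
    linarith

lemma toomCookCost_mono : Monotone toomCookCost :=
  monotone_nat_of_le_succ fun k => by rw [toomCookCost]; omega

lemma coeff_ofCoeffs_mul_eq_zero {as bs : List ℝ} {i : ℕ} (hi : as.length + bs.length ≤ i + 1) :
    (ofCoeffs as * ofCoeffs bs).coeff i = 0 := by
  rw [coeff_mul]
  refine Finset.sum_eq_zero fun x hx => ?_
  rw [Finset.HasAntidiagonal.mem_antidiagonal] at hx
  rcases le_or_gt as.length x.1 with h | h
  · rw [coeff_ofCoeffs_of_length_le h, zero_mul]
  · rw [coeff_ofCoeffs_of_length_le (i := x.2) (by omega), mul_zero]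

lemma runs_mulPoly {p q : ℝ[X]} {L M N : ℕ} {as bs : List ℝ} (ha : Represents p L as)
    (hb : Represents q M bs) (hL : L ≤ N) (hM : M ≤ N) :
    Runs (mulPoly as bs) (toomCookCost (Nat.clog 3 N)) (Represents (p * q) (L + M - 1)) := by
  obtain ⟨rfl, ha⟩ := ha
  obtain ⟨rfl, hb⟩ := hb
  set k := Nat.clog 3 (max as.length bs.length) with hk
  have h3 : max as.length bs.length ≤ 3 ^ k := Nat.le_pow_clog (by norm_num) _
  have hkN : k ≤ Nat.clog 3 N :=
    Nat.clog_mono_right 3 (max_le (ha.trans hL) (hb.trans hM))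
  refine Runs.bind (T₂ := 0) (runs_toomCook k ⟨rfl, (le_max_left _ _).trans h3⟩
    ⟨rfl, (le_max_right _ _).trans h3⟩) (fun r hr => Runs.pure ⟨?_, ?_⟩) |>.le
    (toomCookCost_mono hkN)
  -- The truncation removes only zero padding; without it the lists would grow beyond the bounds
  -- used in `combine`.
  · rw [ofCoeffs_take_of_coeff_eq_zero, hr.1]
    intro i hi
    rw [hr.1, coeff_ofCoeffs_mul_eq_zero (by omega)]
  · exact (List.length_take_le _ _).trans (by omega)

end Multiplication

/-! ### Interpolation -/

section Interpolation

noncomputable def nodal (l : List (ℝ × ℝ)) : ℝ[X] := (l.map fun a => X - C a.1).prod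

/-- The sum of `uᵢ ∏_{j ≠ i} (X - xⱼ)` over the pairs `(xᵢ, uᵢ)` of the list. -/
noncomputable def lagrangeSum : List (ℝ × ℝ) → ℝ[X]
  | [] => 0
  | a :: l => C a.2 * nodal l + (X - C a.1) * lagrangeSum l

lemma nodal_append (l₁ l₂ : List (ℝ × ℝ)) : nodal (l₁ ++ l₂) = nodal l₁ * nodal l₂ := by
  simp [nodal]

lemma nodal_cons (a : ℝ × ℝ) (l : List (ℝ × ℝ)) : nodal (a :: l) = (X - C a.1) * nodal l := by
  simp [nodal]

lemma lagrangeSum_append (l₁ l₂ : List (ℝ × ℝ)) :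
    lagrangeSum (l₁ ++ l₂) = lagrangeSum l₁ * nodal l₂ + lagrangeSum l₂ * nodal l₁ := by
  induction l₁ with
  | nil => simp [lagrangeSum, nodal]
  | cons a l₁ ih =>
    rw [List.cons_append, lagrangeSum, lagrangeSum, ih, nodal_append, nodal_cons]
    ring

lemma degree_lagrangeSum_lt (l : List (ℝ × ℝ)) : (lagrangeSum l).degree < l.length := by
  induction l with
  | nil => simp [lagrangeSum]
  | cons a l ih =>
    have h1 : (nodal l).degree ≤ l.length := by
      have h : (nodal l).natDegree ≤ l.length := by
        have := natDegree_multiset_prod_X_sub_C_eq_card ((l.map Prod.fst : List ℝ) : Multiset ℝ)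
        simp only [Multiset.map_coe, List.map_map, Multiset.prod_coe, Multiset.coe_card,
          List.length_map] at this
        exact this.le
      exact degree_le_of_natDegree_le h
    rw [lagrangeSum]
    refine (degree_add_le _ _).trans_lt (max_lt ?_ ?_)
    · refine ((degree_mul_le _ _).trans (add_le_add degree_C_le h1)).trans_lt ?_
      rw [zero_add]
      exact_mod_cast Nat.lt_succ_self _
    · rw [degree_mul, degree_X_sub_C, List.length_cons, add_comm]
      push_cast
      exact WithBot.add_lt_add_right (by simp) ih

/-- Every summand belonging to another entry contains the factor X - x, so one term survives. Its
factor is the weight by which the data are divided beforehand. -/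
lemma eval_lagrangeSum (u : ℝ → ℝ) {xs : List ℝ} {x : ℝ} (hx : x ∈ xs) :
    (lagrangeSum (xs.map fun x => (x, u x))).eval x
      = u x * ((xs.erase x).map fun y => x - y).prod := by
  have hn : ∀ l : List ℝ, (nodal (l.map fun x => (x, u x))).eval x
      = (l.map fun y => x - y).prod := by
    intro l
    induction l with
    | nil => simp [nodal]
    | cons a l ih => simp [nodal_cons, ih]
  induction xs with
  | nil => simp at hx
  | cons y l ih =>
    rw [List.map_cons, lagrangeSum]
    by_cases hxy : x = y
    · subst hxy
      simp [hn]
    · have hl : x ∈ l := (List.mem_cons.1 hx).resolve_left hxy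
      have h0 : (l.map fun y => x - y).prod = 0 :=
        List.prod_eq_zero (List.mem_map.2 ⟨x, hl, sub_self x⟩)
      rw [List.erase_cons_tail (by simpa using fun h => hxy h.symm), List.map_cons, List.prod_cons]
      simp only [eval_add, eval_mul, eval_C, eval_sub, eval_X, hn, h0, ih hl]
      ring

/-- The size 2 ^ s + 1 occurs because the nodal polynomial of half the nodes has one more
coefficient than there are nodes. -/
def combineCost : ℕ → ℕ
  | 0 => 3
  | s + 1 => 2 * combineCost s + 3 * toomCookCost (Nat.clog 3 (2 ^ s + 1)) + 2 ^ (s + 1)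

lemma one_le_combineCost (s : ℕ) : 1 ≤ combineCost s := by
  induction s with
  | zero => simp [combineCost]
  | succ s ih =>
    rw [combineCost]
    linarith [Nat.zero_le (toomCookCost (Nat.clog 3 (2 ^ s + 1))), Nat.zero_le (2 ^ (s + 1))]

lemma runs_combine (s : ℕ) : ∀ l : List (ℝ × ℝ), l.length ≤ 2 ^ s →
    Runs (combine s l) (combineCost s) fun r =>
      Represents (nodal l) (l.length + 1) r.1 ∧ Represents (lagrangeSum l) l.length r.2 := by
  have hnil : ∀ s, Runs (combine s []) (combineCost s) fun r =>
      Represents (nodal []) (([] : List (ℝ × ℝ)).length + 1) r.1 ∧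
        Represents (lagrangeSum []) ([] : List (ℝ × ℝ)).length r.2 := by
    intro s
    have h : combine s ([] : List (ℝ × ℝ)) = (int 1 >>= fun one => pure ([one], [])) := by
      cases s <;> rfl
    rw [h]
    exact Runs.le (Runs.bind (T₂ := 0) (runs_int 1) fun one h1 => Runs.pure
      ⟨⟨by simp [ofCoeffs, nodal, h1], by simp⟩, ⟨rfl, by simp⟩⟩) (one_le_combineCost s)
  induction s with
  | zero =>
    intro l hl
    rcases l with _ | ⟨a, _ | _⟩
    · exact hnil 0
    · exact Runs.bind (T₂ := 2) (runs_int 0) fun z hz => Runs.bind (T₂ := 1) (runs_sub z a.1) fun y hy =>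
        Runs.bind (T₂ := 0) (runs_int 1) fun one h1 => Runs.pure
          ⟨⟨by simp [ofCoeffs, nodal, h1, hy, hz]; ring, by simp⟩,
            ⟨by simp [ofCoeffs, lagrangeSum, nodal], by simp⟩⟩
    · simp at hl
  | succ s ih =>
    intro l hl
    rcases l with _ | ⟨a, l⟩
    · exact hnil (s + 1)
    rw [combine]
    generalize a :: l = l at *
    have hpow : 2 ^ (s + 1) = 2 * 2 ^ s := pow_succ' 2 s
    have hsplit : l.take (2 ^ s) ++ l.drop (2 ^ s) = l := List.take_append_drop _ _
    have h1 : (l.take (2 ^ s)).length ≤ 2 ^ s := List.length_take_le _ _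
    have h2 : (l.drop (2 ^ s)).length ≤ 2 ^ s := by rw [List.length_drop]; omega
    have hN : nodal l = nodal (l.take (2 ^ s)) * nodal (l.drop (2 ^ s)) := by
      rw [← nodal_append, hsplit]
    have hF := lagrangeSum_append (l.take (2 ^ s)) (l.drop (2 ^ s))
    have hlen : l.length = (l.take (2 ^ s)).length + (l.drop (2 ^ s)).length := by
      rw [← List.length_append, hsplit]
    rw [hsplit] at hF
    rw [hN, hF]
    generalize l.take (2 ^ s) = l₁ at *
    generalize l.drop (2 ^ s) = l₂ at *
    refine Runs.le (Runs.bind (ih l₁ h1) fun r₁ hr₁ => Runs.bind (ih l₂ h2) fun r₂ hr₂ =>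
      Runs.bind (runs_mulPoly (N := 2 ^ s + 1) hr₁.1 hr₂.1 (by omega) (by omega)) fun M hM =>
      Runs.bind (runs_mulPoly (N := 2 ^ s + 1) hr₁.2 hr₂.1 (by omega) (by omega)) fun F₁ hF₁ =>
      Runs.bind (runs_mulPoly (N := 2 ^ s + 1) hr₂.2 hr₁.1 (by omega) (by omega)) fun F₂ hF₂ =>
      Runs.bind (runs_addL (L := l.length) (hF₁.mono (by omega)) (hF₂.mono (by omega)))
        fun F hF => Runs.pure ⟨hM.mono (by omega), hF⟩) ?_
    rw [combineCost]
    omega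

lemma runs_prodDiff (x : ℝ) (l : List ℝ) :
    Runs (prodDiff x l) (1 + 2 * l.length) (· = (l.map fun y => x - y).prod) := by
  induction l with
  | nil => exact (runs_int 1).mono le_rfl (by simp)
  | cons y l ih =>
    refine Runs.le (Runs.bind (runs_sub x y) fun t ht => Runs.bind ih fun r hr =>
      (runs_mul t r).mono le_rfl fun w hw => ?_) (by rw [List.length_cons]; omega)
    simp [hw, ht, hr]

/-- The product of the differences of `x` to the other entries of the list. -/
noncomputable def nodeWeight (xs : List ℝ) (x : ℝ) : ℝ := ((xs.erase x).map fun y => x - y).prod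

lemma nodeWeight_ne_zero {xs : List ℝ} (h : xs.Nodup) (x : ℝ) : nodeWeight xs x ≠ 0 := by
  refine List.prod_ne_zero fun h0 => ?_
  obtain ⟨y, hy, hxy⟩ := List.mem_map.1 h0
  rw [h.mem_erase_iff] at hy
  exact hy.1 (sub_eq_zero.1 hxy).symm

lemma runs_nodeWeights (pre post : List ℝ) (h : (pre ++ post).Nodup) :
    Runs (nodeWeights pre post) (post.length * (1 + 2 * (pre ++ post).length))
      (· = post.map (nodeWeight (pre ++ post))) := by
  induction post generalizing pre with
  | nil => exact Runs.le (Runs.pure (a := []) rfl) (Nat.zero_le _)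
  | cons x post ih =>
    have happ : pre ++ [x] ++ post = pre ++ x :: post := by simp
    have hx : x ∉ pre := fun hx => (List.nodup_append.1 h).2.2 x hx x (by simp) rfl
    have herase : (pre ++ x :: post).erase x = pre ++ post := by
      rw [List.erase_append_right _ hx, List.erase_cons_head]
    have ih' := ih (pre ++ [x]) (by rwa [happ])
    rw [happ] at ih'
    refine Runs.le (Runs.bind (runs_prodDiff x (pre ++ post)) fun w hw => Runs.bind ih' fun ws hws =>
      Runs.pure ?_) ?_
    · rw [hw, hws, List.map_cons, nodeWeight, herase]
    · simp only [List.length_append, List.length_cons]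
      nlinarith

lemma runs_interpolate {xs : List ℝ} (h : xs.Nodup) {Q : ℝ[X]} (hQ : Q.degree < xs.length) :
    Runs (interpolate xs (xs.map (nodeWeight xs)) (xs.map fun x => Q.eval x))
      (xs.length + combineCost (Nat.clog 2 xs.length)) fun r => ofCoeffs r = Q := by
  have hzip : (xs.map fun x => Q.eval x).zip (xs.map (nodeWeight xs))
      = xs.map fun x => (Q.eval x, nodeWeight xs x) := List.zip_map'
  -- Both sides have degree below the number of distinct nodes and agree at all of them.
  have hlag : lagrangeSum (xs.map fun x => (x, Q.eval x / nodeWeight xs x)) = Q := by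
    refine eq_of_degrees_lt_of_eval_finset_eq xs.toFinset ?_ ?_ ?_
    · rw [List.toFinset_card_of_nodup h]
      simpa using degree_lagrangeSum_lt (xs.map fun x => (x, Q.eval x / nodeWeight xs x))
    · rwa [List.toFinset_card_of_nodup h]
    · intro x hx
      rw [eval_lagrangeSum (fun x => Q.eval x / nodeWeight xs x) (List.mem_toFinset.1 hx)]
      exact div_mul_cancel₀ _ (nodeWeight_ne_zero h x)
  rw [interpolate, hzip]
  refine Runs.le (Runs.bind (runs_mapList (T := 1) (fun a => a.1 / a.2) _ fun a ha => ?_)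
    fun us hus => Runs.bind (T₂ := 0) (runs_combine (Nat.clog 2 xs.length) (xs.zip us) ?_)
      fun r hr => Runs.pure ?_) (by simp)
  · obtain ⟨x, -, rfl⟩ := List.mem_map.1 ha
    exact runs_div (nodeWeight_ne_zero h x)
  · rw [List.length_zip]
    exact (min_le_left _ _).trans (Nat.le_pow_clog (by norm_num) _)
  · rw [hr.2.1, ← hlag, hus, List.map_map]
    congr 1
    have h := List.zip_map' (f := id) (g := fun x => Q.eval x / nodeWeight xs x) (l := xs)
    rwa [List.map_id] at h

/-- From 25 ≤ 27 one gets 5^c ≤ (3^c)^(3/2), and 3^c ≤ 3 * 2^s; the constant 6 bounds √27. A product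
of polynomials of size M = 2^s thus costs O(M^(3/2)). -/
lemma five_pow_clog_le (s : ℕ) : ((5 : ℝ) ^ Nat.clog 3 (2 ^ s + 1)) ≤ 6 * √8 ^ s := by
  set c := Nat.clog 3 (2 ^ s + 1) with hc
  have h1 : 3 ^ c ≤ 3 * 2 ^ s := by
    have hpos : 1 < 2 ^ s + 1 := by have := Nat.pow_pos (n := s) (show 0 < 2 by norm_num); omega
    have h := Nat.pow_pred_clog_lt_self (b := 3) (by norm_num) hpos
    have hc0 : 0 < c := Nat.clog_pos (by norm_num) hpos
    rw [← hc] at h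
    obtain ⟨c', hc'⟩ : ∃ c', c = c' + 1 := ⟨c - 1, by omega⟩
    rw [hc', Nat.pred_succ] at h
    rw [hc', pow_succ']
    omega
  have h2 : ((3 : ℝ) ^ c) ≤ 3 * 2 ^ s := by exact_mod_cast h1
  refine le_of_sq_le_sq ?_ (by positivity)
  calc ((5 : ℝ) ^ c) ^ 2 = 25 ^ c := by rw [← pow_mul, mul_comm, pow_mul]; norm_num
    _ ≤ 27 ^ c := pow_le_pow_left₀ (by norm_num) (by norm_num) c
    _ = (3 ^ c) ^ 3 := by rw [← pow_mul, mul_comm, pow_mul]; norm_num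
    _ ≤ (3 * 2 ^ s) ^ 3 := pow_le_pow_left₀ (by positivity) h2 3
    _ = 27 * 8 ^ s := by
        rw [mul_pow, ← pow_mul, mul_comm s, pow_mul]
        norm_num
    _ ≤ 36 * 8 ^ s := mul_le_mul_of_nonneg_right (by norm_num) (by positivity)
    _ = (6 * √8 ^ s) ^ 2 := by
        rw [mul_pow, ← pow_mul, mul_comm s, pow_mul, Real.sq_sqrt (by norm_num)]
        norm_num

/-- Two halves against a growth factor √8 ≥ 2.8: the induction closes because 2 * 1050 + 3 * 46 * 6
+ 2 = 2930 is at most 2.8 * 1050 = 2940. -/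
lemma combineCost_le (s : ℕ) : (combineCost s : ℝ) ≤ 1050 * √8 ^ s := by
  have hr : (2.8 : ℝ) ≤ √8 := Real.le_sqrt_of_sq_le (by norm_num)
  induction s with
  | zero => simp [combineCost]; norm_num
  | succ s ih =>
    have h1 : ((toomCookCost (Nat.clog 3 (2 ^ s + 1)) : ℕ) : ℝ) ≤ 46 * (6 * √8 ^ s) := by
      refine le_trans ?_ (mul_le_mul_of_nonneg_left (five_pow_clog_le s) (by norm_num))
      have := toomCookCost_le (Nat.clog 3 (2 ^ s + 1))
      have h : toomCookCost (Nat.clog 3 (2 ^ s + 1)) ≤ 46 * 5 ^ Nat.clog 3 (2 ^ s + 1) := by omega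
      exact_mod_cast h
    have h2 : (2 : ℝ) ^ s ≤ √8 ^ s := pow_le_pow_left₀ (by norm_num) (by linarith) s
    have h3 : 2.8 * √8 ^ s ≤ √8 * √8 ^ s := mul_le_mul_of_nonneg_right hr (by positivity)
    rw [combineCost, pow_succ']
    push_cast
    rw [pow_succ']
    nlinarith

/-- The bound O(N^(3/2)), squared so that it can be stated in ℕ; rounding N up to a power of two
costs at most a factor 2 in the size. -/
lemma combineCost_clog_sq_le {N : ℕ} (hN : 2 ≤ N) :
    combineCost (Nat.clog 2 N) ^ 2 ≤ 1050 ^ 2 * (8 * N ^ 3) := by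
  have h1 : 2 ^ Nat.clog 2 N ≤ 2 * N := by
    have h := Nat.pow_pred_clog_lt_self (b := 2) (by norm_num) (show 1 < N by omega)
    have hc0 : 0 < Nat.clog 2 N := Nat.clog_pos (by norm_num) hN
    obtain ⟨c', hc'⟩ : ∃ c', Nat.clog 2 N = c' + 1 := ⟨Nat.clog 2 N - 1, by omega⟩
    rw [hc', Nat.pred_succ] at h
    rw [hc', pow_succ']
    omega
  have h2 : 8 ^ Nat.clog 2 N ≤ 8 * N ^ 3 := by
    calc 8 ^ Nat.clog 2 N = (2 ^ Nat.clog 2 N) ^ 3 := by rw [← pow_mul, mul_comm, pow_mul]; norm_num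
      _ ≤ (2 * N) ^ 3 := Nat.pow_le_pow_left h1 3
      _ = 8 * N ^ 3 := by ring
  have h3 : ((combineCost (Nat.clog 2 N) : ℝ)) ^ 2 ≤ 1050 ^ 2 * 8 ^ Nat.clog 2 N := by
    calc ((combineCost (Nat.clog 2 N) : ℝ)) ^ 2 ≤ (1050 * √8 ^ Nat.clog 2 N) ^ 2 :=
          pow_le_pow_left₀ (by positivity) (combineCost_le _) 2
      _ = 1050 ^ 2 * 8 ^ Nat.clog 2 N := by
          rw [mul_pow, ← pow_mul, mul_comm _ 2, pow_mul, Real.sq_sqrt (by norm_num)]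
  have h4 : combineCost (Nat.clog 2 N) ^ 2 ≤ 1050 ^ 2 * 8 ^ Nat.clog 2 N := by exact_mod_cast h3
  exact h4.trans (Nat.mul_le_mul_left _ h2)

end Interpolation

end Prog

namespace Prog

/-! ### The signed Euclidean algorithm on reversed coefficient lists -/

section SignedEuclid

/-- The right side is (X^k f)' divided by X^(k-1). Applied with k = 1 to the tail of p it is p'. -/
lemma runs_derivFrom (k : ℕ) (l : List ℝ) : Runs (derivFrom k l) (2 * l.length) fun r =>
    ofCoeffs r = C (k : ℝ) * ofCoeffs l + X * derivative (ofCoeffs l) ∧ r.length = l.length := by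
  induction l generalizing k with
  | nil => exact Runs.pure ⟨by simp [ofCoeffs], rfl⟩
  | cons a l ih =>
    refine Runs.le (Runs.bind (runs_int k) fun c hc => Runs.bind (runs_mul c a) fun t ht =>
      Runs.bind (ih (k + 1)) fun r hr => Runs.pure ⟨?_, by simp [hr.2]⟩)
      (by rw [List.length_cons]; omega)
    simp only [ofCoeffs, ht, hc, hr.1, derivative_add, derivative_C, derivative_mul, derivative_X,
      C_mul, Nat.cast_add, Nat.cast_one, C_add, C_1, Int.cast_natCast]
    ring

lemma runs_subScaled (x : ℝ) (as bs : List ℝ) (h : bs.length ≤ as.length) :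
    Runs (subScaled x as bs) (2 * bs.length) fun r =>
      ofCoeffs r = ofCoeffs as - C x * ofCoeffs bs ∧ r.length = as.length := by
  induction as generalizing bs with
  | nil =>
    obtain rfl : bs = [] := by simpa using h
    exact Runs.pure ⟨by simp [ofCoeffs], rfl⟩
  | cons a as ih =>
    cases bs with
    | nil => exact Runs.pure ⟨by simp [ofCoeffs], rfl⟩
    | cons b bs =>
      refine Runs.le (Runs.bind (runs_mul x b) fun t ht => Runs.bind (runs_sub a t) fun s hs =>
        Runs.bind (ih bs (by simpa using h)) fun r hr => Runs.pure ⟨?_, by simp [hr.2]⟩)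
        (by rw [List.length_cons]; omega)
      simp only [ofCoeffs, hs, ht, hr.1, C_sub, C_mul]
      ring

/-- With leading coefficients first, `ofCoeffs` is the reversed polynomial, and long division
becomes division of power series: s steps give a quotient u with s coefficients and an error
divisible by X^s. -/
lemma runs_remLoop {b : ℝ} (hb : b ≠ 0) (bs : List ℝ) (s : ℕ) (A : List ℝ)
    (h : bs.length + s ≤ A.length) :
    Runs (remLoop b bs s A) (s * (1 + 2 * bs.length)) fun r =>
      r.length = A.length - s ∧ ∃ u : ℝ[X], (∀ i, s ≤ i → u.coeff i = 0) ∧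
        ofCoeffs A = u * ofCoeffs (b :: bs) + X ^ s * ofCoeffs r := by
  induction s generalizing A with
  | zero => exact (Runs.pure ⟨rfl, 0, by simp, by simp⟩).le (Nat.zero_le _)
  | succ s ih =>
    rcases A with _ | ⟨a, as⟩
    · simp at h
    rw [List.length_cons] at h
    refine Runs.le (Runs.bind (runs_div (x := a) hb) fun x hx =>
      Runs.bind (runs_subScaled x as bs (by omega)) fun as' has' =>
      (ih as' (by omega)).mono le_rfl ?_) (T := 1 + (2 * bs.length + s * (1 + 2 * bs.length))) ?_
    · rintro r ⟨hlen, u, hu, hdiv⟩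
      refine ⟨by rw [List.length_cons]; omega, C x + X * u, ?_, ?_⟩
      · rintro (_ | i) hi
        · omega
        · rw [coeff_add, coeff_C_succ, coeff_X_mul, hu i (by omega), add_zero]
      · have hxb : C a = C x * C b := by rw [← C_mul, hx, div_mul_cancel₀ _ hb]
        have h1 : ofCoeffs as = u * ofCoeffs (b :: bs) + X ^ s * ofCoeffs r + C x * ofCoeffs bs := by
          rw [← hdiv, has'.1]
          ring
        rw [ofCoeffs, h1, hxb]
        simp only [ofCoeffs]
        ring
    · exact le_of_eq (by ring)

lemma runs_stripZeros (l : List ℝ) : Runs (stripZeros l) l.length fun r =>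
    ∃ z, z + r.length = l.length ∧ ofCoeffs l = X ^ z * ofCoeffs r ∧
      ∀ b bs, r = b :: bs → b ≠ 0 := by
  induction l with
  | nil => exact Runs.pure ⟨0, rfl, by simp, by simp⟩
  | cons a l ih =>
    refine Runs.le (Runs.bind (T₂ := l.length) (runs_isZero a) fun z hz => ?_)
      (by rw [List.length_cons]; omega)
    cases z with
    | true =>
      refine ih.mono le_rfl ?_
      rintro r ⟨k, h1, h2, h3⟩
      refine ⟨k + 1, by rw [List.length_cons]; omega, ?_, h3⟩
      rw [ofCoeffs, hz.1 rfl, h2, pow_succ']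
      simp [mul_assoc]
    | false =>
      have ha : a ≠ 0 := fun h => by simpa using hz.2 h
      refine (Runs.pure ⟨0, by simp, by simp, ?_⟩).le (Nat.zero_le _)
      rintro b bs h
      rw [List.cons.injEq] at h
      exact h.1 ▸ ha

/-- The `j`-th subresultant of two polynomials given by their coefficients, leading coefficients
first. -/
noncomputable def listSRes (A B : List ℝ) (j : ℕ) : ℝ :=
  if j < B.length then
    subdet (A.length + B.length - 2 - 2 * j) (B.length - 1 - j)
      (ofCoeffs A : PowerSeries ℝ) (ofCoeffs B : PowerSeries ℝ)
  else 0

lemma coeff_zero_ofCoeffs_cons (b : ℝ) (bs : List ℝ) :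
    PowerSeries.coeff 0 (ofCoeffs (b :: bs) : PowerSeries ℝ) = b := by
  rw [Polynomial.coeff_coe, coeff_ofCoeffs]
  rfl

lemma listSRes_length {A : List ℝ} {b : ℝ} {bs : List ℝ} (h : bs.length + 1 < A.length) :
    listSRes A (b :: bs) bs.length
      = revSign ℝ (A.length - (bs.length + 1)) * b ^ (A.length - (bs.length + 1)) := by
  rw [listSRes, if_pos (by simp), List.length_cons, Nat.add_sub_cancel, Nat.sub_self, subdet_zero,
    coeff_zero_ofCoeffs_cons,
    show A.length + (bs.length + 1) - 2 - 2 * bs.length = A.length - (bs.length + 1) by omega]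

/-- The Euclidean step. The remainder carries a factor X^(δ+1) from the division and X^z from its
own leading zeros; each of these δ+1+z = |A| - |R| factors lets one column be expanded with pivot b.
For j above the degree of R both sides vanish. -/
lemma listSRes_of_lt {A bs R R₁ : List ℝ} {b : ℝ} {u : ℝ[X]} {j z : ℕ}
    (h : bs.length + 1 < A.length) (hj : j < bs.length)
    (hu : ∀ i, A.length - (bs.length + 1) + 1 ≤ i → u.coeff i = 0)
    (hA : ofCoeffs A = u * ofCoeffs (b :: bs)
      - X ^ (A.length - (bs.length + 1) + 1) * ofCoeffs R₁)
    (hR₁ : ofCoeffs R₁ = X ^ z * ofCoeffs R) (hz : z + R.length = bs.length) :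
    listSRes A (b :: bs) j = revSign ℝ (A.length - (bs.length + 1)) * b ^ (A.length - R.length)
      * listSRes (b :: bs) R j := by
  obtain ⟨δ, hδ⟩ : ∃ δ, A.length = bs.length + 1 + δ := ⟨A.length - (bs.length + 1), by omega⟩
  obtain ⟨a, ha⟩ : ∃ a, bs.length = j + a := ⟨bs.length - j, by omega⟩
  have hδ' : A.length - (bs.length + 1) = δ := by omega
  rw [hδ'] at hu hA ⊢
  have hA' : (ofCoeffs A : PowerSeries ℝ) = (u : PowerSeries ℝ) * (ofCoeffs (b :: bs) : PowerSeries ℝ)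
      - PowerSeries.X ^ (δ + 1) * (PowerSeries.X ^ z * (ofCoeffs R : PowerSeries ℝ)) := by
    rw [hA, hR₁]
    push_cast
    rfl
  rw [listSRes, if_pos (by rw [List.length_cons]; omega), List.length_cons,
    show A.length + (bs.length + 1) - 2 - 2 * j = a + a + δ by omega,
    show bs.length + 1 - 1 - j = a by omega,
    subdet_remainder (Nat.lt_succ_self δ) u
      (natDegree_le_iff_coeff_eq_zero.2 fun i hi => hu i hi) hA', ← mul_assoc, ← pow_add,
    show A.length - R.length = δ + 1 + z by omega, mul_assoc]
  congr 1
  by_cases hjR : j < R.length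
  · rw [listSRes, if_pos hjR, List.length_cons]
    have h1 := subdet_X_pow_mul (bs.length + 1 + R.length - 2 - 2 * j) (R.length - 1 - j)
      (δ + 1 + z) (ofCoeffs R : PowerSeries ℝ) (ofCoeffs (b :: bs) : PowerSeries ℝ)
    rw [show bs.length + 1 + R.length - 2 - 2 * j + (δ + 1 + z) = a + a + δ by omega,
      show R.length - 1 - j + (δ + 1 + z) = a + δ by omega, coeff_zero_ofCoeffs_cons] at h1
    exact h1
  · rw [listSRes, if_neg hjR, mul_zero]
    exact subdet_X_pow_mul_eq_zero (by omega) (by omega) _ _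

/-- Matches one round of `sResLoop`: the recursive entries, the entry at the degree of B, and the
constant gap above it. -/
lemma map_range_eq_append {α : Type*} {F : ℕ → α} {a : α} (q k : ℕ)
    (h : ∀ i, F (q + 1 + i) = a) :
    (List.range (q + 1 + k)).map F = (List.range q).map F ++ F q :: List.replicate k a := by
  rw [List.range_add, List.range_succ, List.map_append, List.map_append, List.map_map,
    List.append_assoc]
  congr 1
  simp only [List.map_cons, List.map_nil, List.singleton_append, List.cons.injEq, true_and]
  rw [List.eq_replicate_iff]
  refine ⟨by simp, fun x hx => ?_⟩
  obtain ⟨i, -, rfl⟩ := List.mem_map.1 hx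
  exact h i

/-- The quadratic bound is amortised with the potential |A| + |B|. One round lowers it by w = |A| -
|R|, while the division takes δ + 1 ≤ w steps of cost O(L). Since B becomes shorter in every round,
the fuel f suffices. -/
lemma runs_sResLoop (L f : ℕ) (μ : ℝ) (A B : List ℝ) (hf : B.length ≤ f)
    (hAB : B.length < A.length) (hL : A.length ≤ L) (hB : ∀ b bs, B = b :: bs → b ≠ 0) :
    Runs (sResLoop f μ A B) ((4 * L + 11) * (A.length + B.length) + 1)
      (· = ((List.range (A.length - 1)).map fun j => μ * listSRes A B j).reverse) := by
  induction f generalizing μ A B with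
  | zero =>
    obtain rfl : B = [] := by simpa using hf
    refine (runs_zeros (A.length - 1)).mono (by omega) fun r hr => ?_
    rw [hr]
    simp [listSRes]
  | succ f ih =>
    rcases B with _ | ⟨b, bs⟩
    · refine (runs_zeros (A.length - 1)).mono (by omega) fun r hr => ?_
      rw [hr]
      simp [listSRes]
    rw [List.length_cons] at hf hAB
    have hb := hB b bs rfl
    rw [sResLoop]
    set δ := A.length - (bs.length + 1) with hδ
    -- The tail of the round is granted what is left of the budget. The division, whose length
    -- depends on R, can then be charged once R is known.
    refine Runs.le (Runs.bind (runs_int _) fun ε hε => Runs.bind (runs_mul μ ε) fun ν hν =>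
      Runs.bind (runs_pow b δ) fun y hy => Runs.bind (runs_mul ν y) fun s hs =>
      Runs.bind (runs_zeros (δ - 1)) fun z hz =>
      Runs.bind (runs_remLoop hb bs (δ + 1) A (by omega)) fun R₀ hR₀ =>
      Runs.bind ((runs_negL_list R₀).le (T' := 1 + bs.length) (by omega)) fun R₁ hR₁ =>
      Runs.bind ((runs_stripZeros R₁).le (T' := bs.length) (by omega)) fun R hR =>
      (?_ : Runs _ ((4 * L + 11) * (A.length + (bs.length + 1)) + 1
        - (7 + δ + (δ + 1) * (1 + 2 * bs.length) + 2 * bs.length)) _)) ?_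
    · obtain ⟨k, hk, hR₁R, hhead⟩ := hR
      obtain ⟨hlen₀, u, hu, hA⟩ := hR₀
      have hk' : k + R.length = bs.length := by omega
      refine Runs.le (Runs.bind (runs_pow b _) fun w hw => Runs.bind (runs_mul ν w) fun μ' hμ' =>
        Runs.bind (ih μ' (b :: bs) R (by omega) (by rw [List.length_cons]; omega)
          (by rw [List.length_cons]; omega) hhead) fun rest hrest => Runs.pure ?_) ?_
      · have hε' : ε = revSign ℝ δ := by rw [hε, revSign]; push_cast; rfl
        have hA' : ofCoeffs A = u * ofCoeffs (b :: bs) - X ^ (δ + 1) * ofCoeffs R₁ := by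
          rw [hA, hR₁.1]
          ring
        have hrange : A.length - 1 = bs.length + 1 + (δ - 1) := by omega
        rw [hrange, map_range_eq_append (a := 0), List.reverse_append, List.reverse_cons,
          List.reverse_replicate, hz, hrest, List.append_assoc]
        · rw [List.singleton_append, listSRes_length hAB, hs, hν, hε', hy, List.length_cons,
            Nat.add_sub_cancel, ← hδ, mul_assoc]
          congr 3
          refine List.map_congr_left fun j hj => ?_
          rw [listSRes_of_lt hAB (List.mem_range.1 hj) hu hA' hR₁R hk', hμ', hν, hε', hw]
          ring
        · intro i
          rw [listSRes, if_neg (by rw [List.length_cons]; omega), mul_zero]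
      · rw [List.length_cons]
        obtain ⟨w, hw⟩ : ∃ w, A.length = R.length + w := ⟨A.length - R.length, by omega⟩
        have hw' : A.length - R.length = w := by omega
        have h1 : (δ + 1) * (1 + 2 * bs.length) ≤ w * (1 + 2 * L) :=
          Nat.mul_le_mul (by omega) (by omega)
        have h2 : 2 * bs.length ≤ w * L := Nat.mul_le_mul (by omega) (by omega)
        refine Nat.le_sub_of_add_le ?_
        rw [hw']
        have h3 : (4 * L + 11) * (A.length + (bs.length + 1))
          = (4 * L + 11) * (bs.length + 1 + R.length) + (4 * (w * L) + 11 * w) := by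
          rw [hw]
          ring
        have h4 : w * (1 + 2 * L) = w + 2 * (w * L) := by ring
        have h5 : δ + 1 ≤ w := by omega
        have h6 : 2 ≤ w := by omega
        omega
    · have h1 : (δ + 1) * (1 + 2 * bs.length) ≤ A.length * (1 + 2 * L) :=
        Nat.mul_le_mul (by omega) (by omega)
      have h2 : (4 * L + 11) * (A.length + (bs.length + 1)) = 2 * (A.length * (1 + 2 * L))
        + 9 * A.length + 4 * (L * (bs.length + 1)) + 11 * (bs.length + 1) := by ring
      rw [List.length_cons]
      omega

lemma ofCoeffs_reverse (l : List ℝ) :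
    ofCoeffs l.reverse = (ofCoeffs l).reflect (l.length - 1) := by
  ext i
  rw [coeff_reflect, coeff_ofCoeffs, coeff_ofCoeffs]
  rcases lt_or_ge i l.length with h | h
  · rw [revAt_le (by omega), List.getD_reverse _ h]
  · rw [List.getD_eq_default _ _ (by simpa using h)]
    rcases Nat.eq_zero_or_pos l.length with h0 | h0
    · rw [List.length_eq_zero_iff.1 h0, List.getD_nil]
    · rw [revAt_eq_self_of_lt (by omega), List.getD_eq_default _ _ h]

lemma runs_allSRes {p : List ℝ} {m : ℕ} (hp : p.length = m + 1)
    (hdeg : (ofCoeffs p).natDegree = m) :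
    Runs (allSRes p) ((4 * m + 15) * (2 * m + 1) + 2 * m + 2)
      (· = (List.range m).map fun k => sRes k (ofCoeffs p)) := by
  have hderiv : Runs (derivFrom 1 p.tail) (2 * m) fun p' =>
      ofCoeffs p' = derivative (ofCoeffs p) ∧ p'.length = m := by
    refine (runs_derivFrom 1 p.tail).mono (by simp [hp]) fun p' hp' => ⟨?_, ?_⟩
    · rw [hp'.1]
      rcases p with _ | ⟨a, p⟩
      · simp at hp
      · simp [ofCoeffs]
    · rw [hp'.2, List.length_tail, hp, Nat.add_sub_cancel]
  have hA : ofCoeffs p.reverse = (ofCoeffs p).reflect m := by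
    rw [ofCoeffs_reverse, hp, Nat.add_sub_cancel]
  have hmain : ∀ p' : List ℝ, ofCoeffs p' = derivative (ofCoeffs p) → p'.length = m → ∀ one : ℝ,
      one = ((1 : ℤ) : ℝ) → Runs (sResLoop p.length one p.reverse p'.reverse)
        ((4 * m + 15) * (2 * m + 1) + 1)
        fun l => l.reverse = (List.range m).map fun k => sRes k (ofCoeffs p) := by
    intro p' hp' hlen one hone
    have hB : ofCoeffs p'.reverse = (derivative (ofCoeffs p)).reflect (m - 1) := by
      rw [ofCoeffs_reverse, hlen, hp']
    refine (runs_sResLoop (m + 1) p.length one p.reverse p'.reverse ?_ ?_ ?_ ?_).mono ?_ ?_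
    · simp [hp, hlen]
    · simp [hp, hlen]
    · simp [hp]
    · intro b bs hbs
      have hm : m - 1 + 1 = m := by
        have h := congrArg List.length hbs
        rw [List.length_reverse, List.length_cons] at h
        omega
      -- The leading coefficient of p' is m times that of p, hence nonzero in characteristic 0; m ≥
      -- 1 because the list of p' is nonempty.
      have hb : b = (ofCoeffs p).coeff m * (((m - 1 : ℕ) : ℝ) + 1) := by
        have h := coeff_zero_ofCoeffs_cons b bs
        rw [← hbs, hB, Polynomial.coeff_coe, coeff_reflect, revAt_le (Nat.zero_le _), Nat.sub_zero,
          coeff_derivative, hm] at h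
        exact h.symm
      have hlead : (ofCoeffs p).coeff m ≠ 0 := by
        intro h
        rw [← hdeg] at h
        have h0 := leadingCoeff_eq_zero.1 h
        rw [h0, natDegree_zero] at hdeg
        omega
      rw [hb]
      exact mul_ne_zero hlead (by positivity)
    · rw [List.length_reverse, List.length_reverse, hp, hlen]
      exact le_of_eq (by ring)
    · intro l hl
      rw [hl, List.reverse_reverse, List.length_reverse, hp, Nat.add_sub_cancel]
      refine List.map_congr_left fun k hk => ?_
      rw [hone, Int.cast_one, one_mul, listSRes, List.length_reverse, List.length_reverse, hp, hlen,
        if_pos (List.mem_range.1 hk), sRes_eq_subdet, hA, hB, hdeg,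
        show m + 1 + m - 2 - 2 * k = 2 * m - 1 - 2 * k by omega]
  exact Runs.le (Runs.bind hderiv fun p' hp' => Runs.bind (runs_int 1) fun one hone =>
    Runs.bind (T₂ := 0) (hmain p' hp'.1 hp'.2 one hone) fun l hl => Runs.pure hl) (by omega)

end SignedEuclid

end Prog

/-! ## The subdiscriminants of a family of polynomials -/

section Family

/-- Pulling a out of column 0 leaves constants there, so every Leibniz term has only N factors that
contribute to the degree. -/
lemma exists_det_eq_mul_of_column_zero {R : Type*} [CommRing R] {N d : ℕ}
    (M : Matrix (Fin (N + 1)) (Fin (N + 1)) R[X]) (a : R[X]) (v : Fin (N + 1) → R)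
    (h0 : ∀ i, M i 0 = a * C (v i)) (hd : ∀ i j, (M i j).natDegree ≤ d) :
    ∃ E : R[X], E.natDegree ≤ N * d ∧ M.det = a * E := by
  let M' : Matrix (Fin (N + 1)) (Fin (N + 1)) R[X] :=
    Matrix.of fun i j => if j = 0 then C (v i) else M i j
  refine ⟨M'.det, ?_, ?_⟩
  · rw [Matrix.det_apply]
    refine natDegree_sum_le_of_forall_le _ _ fun σ _ => ?_
    have h : (∏ i, M' (σ i) i).natDegree ≤ N * d := by
      refine (natDegree_prod_le _ _).trans ?_
      rw [Fin.sum_univ_succ]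
      have h1 : (M' (σ 0) 0).natDegree = 0 := by simp [M']
      rw [h1, zero_add]
      refine (Finset.sum_le_card_nsmul _ _ d fun i _ => ?_).trans (by simp)
      simpa [M', Fin.succ_ne_zero] using hd _ _
    rcases Int.units_eq_one_or (Equiv.Perm.sign σ) with hs | hs
    · simpa [hs] using h
    · simpa [hs] using h
  · have h := Matrix.det_mul_row (fun j => if j = 0 then a else 1) M'
    rw [Finset.prod_ite_eq' Finset.univ 0 (fun _ => a), if_pos (Finset.mem_univ _)] at h
    rw [← h]
    congr 1
    ext1 i j
    rcases eq_or_ne j 0 with rfl | hj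
    · simp [M', h0]
    · simp [M', hj]

variable {n d : ℕ} {c : Fin (n + 1) → ℝ[X]} {m : Fin (n + 1)}

lemma ofCoeffs_ofFn {n : ℕ} (f : Fin n → ℝ) :
    ofCoeffs (List.ofFn f) = ∑ k : Fin n, C (f k) * X ^ (k : ℕ) := by
  induction n with
  | zero => simp [ofCoeffs]
  | succ n ih =>
    rw [List.ofFn_succ, ofCoeffs, ih, Fin.sum_univ_succ, Finset.mul_sum]
    simp only [Fin.val_zero, pow_zero, mul_one, Fin.val_succ, pow_succ']
    congr 1
    refine Finset.sum_congr rfl fun k _ => ?_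
    ring

lemma coeff_member (c : Fin (n + 1) → ℝ[X]) (γ : ℝ) (i : ℕ) :
    (member c γ).coeff i = if h : i < n + 1 then (c ⟨i, h⟩).eval γ else 0 := by
  rw [member, ← ofCoeffs_ofFn fun k => (c k).eval γ, Prog.coeff_ofCoeffs,
    List.getD_eq_getElem?_getD, List.getElem?_ofFn]
  split_ifs <;> rfl

lemma coeff_member_of_lt (hc : ∀ k, m < k → c k = 0) (γ : ℝ) {i : ℕ} (hi : (m : ℕ) < i) :
    (member c γ).coeff i = 0 := by
  rw [coeff_member]
  split_ifs with h
  · rw [hc ⟨i, h⟩ hi, eval_zero]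
  · rfl

lemma coeff_member_self (γ : ℝ) : (member c γ).coeff m = (c m).eval γ := by
  rw [coeff_member, dif_pos m.2]

lemma natDegree_member (hc : ∀ k, m < k → c k = 0) {γ : ℝ} (hγ : (c m).eval γ ≠ 0) :
    (member c γ).natDegree = m :=
  natDegree_eq_of_le_of_coeff_ne_zero
    (natDegree_le_iff_coeff_eq_zero.2 fun _ hi => coeff_member_of_lt hc γ hi)
    (by rwa [coeff_member_self])

/-- The subresultant matrix is written once over ℝ[γ] with formal degree m. Wherever c_m(γ) ≠ 0 this
is the actual degree, and evaluation commutes with the determinant. -/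
lemma exists_eval_eq_sRes_div (hd : ∀ k, (c k).natDegree ≤ d) (hc : ∀ k, m < k → c k = 0) {k : ℕ}
    (hk : k < m) : ∃ Q : ℝ[X], Q.natDegree ≤ 2 * k * d ∧ ∀ γ, (c m).eval γ ≠ 0 →
      Q.eval γ = sRes (m - (k + 1)) (member c γ) / (c m).eval γ := by
  let a : ℕ → ℝ[X] := fun i => if h : i < n + 1 then c ⟨i, h⟩ else 0
  have ha : ∀ γ i, (member c γ).coeff i = (a i).eval γ := by
    intro γ i
    rw [coeff_member]
    simp only [a]
    split_ifs <;> simp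
  have had : ∀ i, (a i).natDegree ≤ d := by
    intro i
    simp only [a]
    split_ifs
    · exact hd _
    · simp
  have ham : a m = c m := by simp only [a, dif_pos m.2]
  let f : PowerSeries ℝ[X] := PowerSeries.mk fun i => if i ≤ (m : ℕ) then a (m - i) else 0
  let g : PowerSeries ℝ[X] :=
    PowerSeries.mk fun i => if i < (m : ℕ) then a (m - i) * C ((m - i : ℕ) : ℝ) else 0
  have hf : ∀ γ, PowerSeries.map (evalRingHom γ) f
      = (((member c γ).reflect m : ℝ[X]) : PowerSeries ℝ) := by
    intro γ
    ext i
    rw [PowerSeries.coeff_map, PowerSeries.coeff_mk, Polynomial.coeff_coe, coeff_reflect]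
    split_ifs with hi
    · rw [revAt_le hi, ha]
      rfl
    · rw [revAt_eq_self_of_lt (by omega), coeff_member_of_lt hc γ (by omega), map_zero]
  have hg : ∀ γ, PowerSeries.map (evalRingHom γ) g
      = (((derivative (member c γ)).reflect (m - 1) : ℝ[X]) : PowerSeries ℝ) := by
    intro γ
    ext i
    rw [PowerSeries.coeff_map, PowerSeries.coeff_mk, Polynomial.coeff_coe, coeff_reflect]
    split_ifs with hi
    · have h1 : (m : ℕ) - 1 - i + 1 = m - i := by omega
      rw [revAt_le (by omega), coeff_derivative, h1, ha, ← h1]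
      simp
    · rw [revAt_eq_self_of_lt (by omega), coeff_derivative, coeff_member_of_lt hc γ (by omega),
        map_zero, zero_mul]
  have hfd : ∀ s j, (PowerSeries.coeff j (PowerSeries.X ^ s * f)).natDegree ≤ d := by
    intro s j
    rw [PowerSeries.coeff_X_pow_mul', PowerSeries.coeff_mk]
    split_ifs <;> simp [had]
  have hgd : ∀ s j, (PowerSeries.coeff j (PowerSeries.X ^ s * g)).natDegree ≤ d := by
    intro s j
    rw [PowerSeries.coeff_X_pow_mul', PowerSeries.coeff_mk]
    split_ifs
    · exact (natDegree_mul_C_le _ _).trans (had _)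
    · simp
    · simp
  obtain ⟨E, hE, hdet⟩ := exists_det_eq_mul_of_column_zero (d := d)
    (subdetMatrix (2 * k + 1) k f g) (c m)
    -- In column 0 only unshifted rows survive: the first row of p (present if k > 0) gives c_m, and
    -- the last row, of p', gives m c_m.
    (fun i => if (i : ℕ) < k then (if (i : ℕ) = 0 then 1 else 0)
      else if 2 * k + 1 - 1 - (i : ℕ) = 0 then (m : ℝ) else 0)
    (by
      intro i
      simp only [subdetMatrix, Matrix.of_apply, Fin.val_zero]
      split_ifs with h1 h2 h2
      · simp [h2, f, ham]
      · simp [h2, PowerSeries.coeff_X_pow_mul']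
      · simp only [h2, g, pow_zero, one_mul, PowerSeries.coeff_mk, Nat.sub_zero, ham]
        rw [if_pos (by omega)]
      · rw [PowerSeries.coeff_X_pow_mul', if_neg (by omega), C_0, mul_zero])
    (by
      intro i j
      simp only [subdetMatrix, Matrix.of_apply]
      split_ifs
      · exact hfd _ _
      · exact hgd _ _)
  refine ⟨E, hE, fun γ hγ => ?_⟩
  rw [eq_div_iff hγ, mul_comm, ← eval_mul, ← hdet, sRes_eq_subdet, natDegree_member hc hγ,
    ← hf, ← hg, show 2 * (m : ℕ) - 1 - 2 * (m - (k + 1)) = 2 * k + 1 by omega,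
    show (m : ℕ) - 1 - (m - (k + 1)) = k by omega, ← subdet_map]
  rfl

lemma sRes_div_eq_sDisc (hc : ∀ k, m < k → c k = 0) {k : ℕ} (hk : k < m) {γ : ℝ}
    (hγ : (c m).eval γ ≠ 0) :
    ((sRes (m - (k + 1)) (member c γ) / (c m).eval γ : ℝ) : ℂ) = sDisc (k + 1) (member c γ) := by
  have hdeg := natDegree_member hc hγ
  have h := sRes_eq_leadingCoeff_mul_sDisc (k := k) (p := member c γ) (by omega)
  have hlead : (member c γ).leadingCoeff = (c m).eval γ := by
    rw [leadingCoeff, hdeg, coeff_member_self]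
  rw [hdeg, hlead] at h
  have hγ' : (((c m).eval γ : ℝ) : ℂ) ≠ 0 := by exact_mod_cast hγ
  rw [Complex.ofReal_div, h, mul_div_cancel_left₀ _ hγ']

/-- The polynomials that interpolate the subdiscriminants. -/
lemma exists_subdiscriminant_polynomials (hn : 1 ≤ n) (hd1 : 1 ≤ d) (hd : ∀ k, (c k).natDegree ≤ d)
    (hc : ∀ k, m < k → c k = 0) : ∃ Q : ℕ → ℝ[X], ∀ k, k < n →
      (Q k).natDegree < 2 * d * n ∧ ∀ γ, (c m).eval γ ≠ 0 →
        ((Q k).eval γ = if k < m then sRes (m - (k + 1)) (member c γ) / (c m).eval γ else 0) ∧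
        (((Q k).eval γ : ℝ) : ℂ) = sDisc (k + 1) (member c γ) := by
  have h : ∀ k, ∃ Q : ℝ[X], k < n → Q.natDegree < 2 * d * n ∧ ∀ γ, (c m).eval γ ≠ 0 →
      (Q.eval γ = if k < m then sRes (m - (k + 1)) (member c γ) / (c m).eval γ else 0) := by
    intro k
    by_cases hk : k < m
    · obtain ⟨Q, hQ, hQ'⟩ := exists_eval_eq_sRes_div hd hc hk
      refine ⟨Q, fun hkn => ⟨hQ.trans_lt ?_, fun γ hγ => by rw [if_pos hk, hQ' γ hγ]⟩⟩
      -- The strict inequality 2kd < 2dn, from k < n and d ≥ 1, is what makes 2dn nodes enough.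
      rw [mul_right_comm]
      exact Nat.mul_lt_mul_of_pos_left hkn (by omega)
    · exact ⟨0, fun _ => ⟨by rw [natDegree_zero]; positivity, fun γ _ => by
        rw [if_neg hk, eval_zero]⟩⟩
  choose Q hQ using h
  refine ⟨Q, fun k hk => ⟨(hQ k hk).1, fun γ hγ => ⟨(hQ k hk).2 γ hγ, ?_⟩⟩⟩
  rw [(hQ k hk).2 γ hγ]
  split_ifs with hkm
  · exact sRes_div_eq_sDisc hc hkm hγ
  · rw [sDisc_eq_zero (by rw [natDegree_member hc hγ]; omega), Complex.ofReal_zero]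

end Family

namespace Prog

/-! ### The complete run: correctness and operation count -/

section FastRR

lemma runs_trimRows_eq_nil {w : ℕ} (rs : List (List ℝ)) (hw : ∀ r ∈ rs, r.length ≤ w)
    (h0 : ∀ r ∈ rs, ∀ a ∈ r, a = 0) : Runs (trimRows rs) (rs.length * w) (· = []) := by
  induction rs with
  | nil => exact Runs.le (Runs.pure (a := []) rfl) (Nat.zero_le _)
  | cons r rs ih =>
    refine Runs.le (Runs.bind (T₂ := w) (ih (fun r hr => hw r (by simp [hr]))
      fun r hr => h0 r (by simp [hr])) fun rs' hrs' => ?_)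
      (by rw [List.length_cons, add_mul, one_mul])
    rw [hrs']
    refine Runs.le (Runs.bind (T₂ := 0) (runs_allZero r) fun z hz => Runs.pure ?_)
      (by simpa using hw r (by simp))
    rw [hz.2 (h0 r (by simp)), if_pos rfl]

lemma runs_trimRows {w : ℕ} (pre : List (List ℝ)) (r : List ℝ) (post : List (List ℝ))
    (hw : ∀ s ∈ pre ++ r :: post, s.length ≤ w) (hr : ∃ a ∈ r, a ≠ 0)
    (h0 : ∀ s ∈ post, ∀ a ∈ s, a = 0) :
    Runs (trimRows (pre ++ r :: post)) ((pre ++ r :: post).length * w) (· = pre ++ [r]) := by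
  induction pre with
  | nil =>
    refine Runs.le (Runs.bind (T₂ := w) (runs_trimRows_eq_nil post
      (fun s hs => hw s (by simp [hs])) h0) fun rs' hrs' => ?_)
      (by rw [List.nil_append, List.length_cons, add_mul, one_mul])
    rw [hrs']
    refine Runs.le (Runs.bind (T₂ := 0) (runs_allZero r) fun z hz => Runs.pure ?_)
      (by simpa using hw r (by simp))
    have hz' : ¬ z = true := fun h => by
      obtain ⟨a, ha, hne⟩ := hr
      exact hne (hz.1 h a ha)
    rw [if_neg hz', List.nil_append]
  | cons s pre ih =>
    refine Runs.le (Runs.bind (T₂ := 0) (ih fun s hs => hw s (by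
      rw [List.cons_append]; exact List.mem_cons_of_mem _ hs)) fun rs' hrs' => ?_) ?_
    · rw [hrs', if_neg (by simp)]
      exact Runs.pure rfl
    · exact Nat.mul_le_mul_right _ (by simp)

open Classical in
lemma runs_goodPoints (top : List ℝ) (js : List ℕ) :
    Runs (goodPoints top js) (js.length * (3 + 2 * top.length))
      (· = ((js.map (Nat.cast : ℕ → ℝ)).filter fun x => (ofCoeffs top).eval x ≠ 0).map
        fun x => (x, (ofCoeffs top).eval x)) := by
  induction js with
  | nil => exact Runs.le (Runs.pure (a := []) rfl) (Nat.zero_le _)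
  | cons j js ih =>
    refine Runs.le (Runs.bind (runs_int j) fun x hx => Runs.bind (runs_evalAt top x) fun v hv =>
      Runs.bind (runs_isZero v) fun z hz => Runs.bind ih fun rest hrest => Runs.pure ?_) ?_
    · rw [Int.cast_natCast] at hx
      subst hx
      rw [List.map_cons]
      by_cases h : (ofCoeffs top).eval (j : ℝ) = 0
      · rw [List.filter_cons_of_neg (by simpa using h), hz.2 (by rw [hv, h]), if_pos rfl, hrest]
      · rw [List.filter_cons_of_pos (by simpa using h), List.map_cons,
          if_neg (fun hz' => h (by rw [← hv, hz.1 hz'])), hrest, hv]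
    · rw [List.length_cons, add_mul, one_mul]
      omega

-- The discarded points are distinct roots of P, so at most deg P of them are lost.
open Classical in
lemma length_le_length_filter_add_natDegree {P : ℝ[X]} (hP : P ≠ 0) {xs : List ℝ}
    (hxs : xs.Nodup) :
    xs.length ≤ (xs.filter fun x => P.eval x ≠ 0).length + P.natDegree := by
  have h1 := List.length_eq_length_filter_add (l := xs) fun x => decide (P.eval x ≠ 0)
  rw [h1]
  refine Nat.add_le_add_left ?_ _
  rw [← List.toFinset_card_of_nodup (hxs.filter _)]
  refine le_trans (Finset.card_le_card ?_) ((Multiset.toFinset_card_le _).trans (card_roots' P))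
  intro x hx
  rw [Multiset.mem_toFinset, mem_roots hP]
  simpa using (List.mem_filter.1 (List.mem_toFinset.1 hx)).2

lemma map_eq_map_of_forall₂ {α β γ : Type*} {f : β → γ} {g : α → γ} {as : List α} {bs : List β}
    (h : List.Forall₂ (fun a b => f b = g a) as bs) : bs.map f = as.map g := by
  induction h with
  | nil => rfl
  | cons h _ ih => rw [List.map_cons, List.map_cons, h, ih]

lemma filterMap_eq_map_of_forall₂ {α β γ : Type*} {P : α → β → Prop} {f : β → Option γ} {g : α → γ}
    {as : List α} {bs : List β} (h : List.Forall₂ P as bs)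
    (hP : ∀ a ∈ as, ∀ b, P a b → f b = some (g a)) : bs.filterMap f = as.map g := by
  induction h with
  | nil => rfl
  | cons h _ ih =>
    rw [List.filterMap_cons_some (hP _ (by simp) _ h), List.map_cons,
      ih fun a ha => hP a (by simp [ha])]

variable {n d : ℕ} {c : Fin (n + 1) → ℝ[X]} {m : Fin (n + 1)}

lemma ofCoeffs_coeff {p : ℝ[X]} (hp : p.natDegree ≤ d) :
    ofCoeffs (List.ofFn fun j : Fin (d + 1) => p.coeff j) = p := by
  rw [ofCoeffs_ofFn, Fin.sum_univ_eq_sum_range fun j => C (p.coeff j) * X ^ j]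
  exact (p.as_sum_range_C_mul_X_pow' (Nat.lt_succ_of_le hp)).symm

/-- The coefficients of `c₀, …, cₘ`. -/
noncomputable def coeffRows (d : ℕ) (c : Fin (n + 1) → ℝ[X]) (m : Fin (n + 1)) : List (List ℝ) :=
  (List.ofFn fun k => List.ofFn fun j : Fin (d + 1) => (c k).coeff j).take (m + 1)

lemma length_coeffRows : (coeffRows d c m).length = m + 1 := by
  rw [coeffRows, List.length_take, List.length_ofFn]
  omega

lemma coeffRows_eq_append :
    coeffRows d c m
      = (List.ofFn fun k => List.ofFn fun j : Fin (d + 1) => (c k).coeff j).take m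
        ++ [List.ofFn fun j : Fin (d + 1) => (c m).coeff j] := by
  rw [coeffRows, List.take_add_one, List.getElem?_ofFn, dif_pos m.2]
  rfl

lemma length_of_mem_coeffRows {r : List ℝ} (hr : r ∈ coeffRows d c m) : r.length = d + 1 := by
  obtain ⟨k, rfl⟩ := (List.mem_ofFn' _ _).1 (List.mem_of_mem_take hr)
  rw [List.length_ofFn]

lemma runs_trimRows_coeff (hd : ∀ k, (c k).natDegree ≤ d) (hcm : c m ≠ 0)
    (hc : ∀ k, m < k → c k = 0) :
    Runs (trimRows (List.ofFn fun k => List.ofFn fun j : Fin (d + 1) => (c k).coeff j))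
      ((n + 1) * (d + 1)) (· = coeffRows d c m) := by
  set l := List.ofFn fun k => List.ofFn fun j : Fin (d + 1) => (c k).coeff j with hl
  have hlen : l.length = n + 1 := List.length_ofFn
  have hsplit : l = l.take m ++ (List.ofFn fun j : Fin (d + 1) => (c m).coeff j)
      :: l.drop (m + 1) := by
    conv_lhs => rw [← List.take_append_drop (m + 1) l]
    change coeffRows d c m ++ _ = _
    rw [coeffRows_eq_append, List.append_assoc, List.singleton_append]
  have h := runs_trimRows (w := d + 1) (l.take m) (List.ofFn fun j : Fin (d + 1) => (c m).coeff j)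
    (l.drop (m + 1)) ?_ ?_ ?_
  · rw [← hsplit, hlen] at h
    rw [coeffRows_eq_append]
    exact h
  · intro s hs
    rw [← hsplit] at hs
    obtain ⟨k, rfl⟩ := (List.mem_ofFn' _ _).1 hs
    rw [List.length_ofFn]
  · by_contra hne
    push Not at hne
    refine hcm ?_
    ext j
    rcases Nat.lt_or_ge d j with hj | hj
    · rw [coeff_eq_zero_of_natDegree_lt ((hd m).trans_lt hj), coeff_zero]
    · exact hne _ ((List.mem_ofFn' _ _).2 ⟨⟨j, Nat.lt_succ_of_le hj⟩, rfl⟩)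
  · intro s hs a ha
    obtain ⟨i, hi, rfl⟩ := List.mem_iff_getElem.1 hs
    rw [List.getElem_drop] at ha
    simp only [hl, List.getElem_ofFn] at ha
    obtain ⟨j, rfl⟩ := (List.mem_ofFn' _ _).1 ha
    simp only
    rw [hc _ (by rw [Fin.lt_def]; simp only; omega), coeff_zero]

lemma runs_evalRows (hd : ∀ k, (c k).natDegree ≤ d) (hc : ∀ k, m < k → c k = 0) (x : ℝ) :
    Runs (mapList (fun row => evalAt row x) (coeffRows d c m)) ((m + 1) * (1 + 2 * (d + 1)))
      fun p => p.length = m + 1 ∧ ofCoeffs p = member c x := by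
  refine (runs_mapList (fun row => (ofCoeffs row).eval x) (coeffRows d c m)
    (T := 1 + 2 * (d + 1)) fun row hrow => ?_).mono (by rw [length_coeffRows]) fun p hp => ⟨?_, ?_⟩
  · rw [← length_of_mem_coeffRows hrow]
    exact runs_evalAt row x
  · rw [hp, List.length_map, length_coeffRows]
  · have h : ((List.ofFn fun k => List.ofFn fun j : Fin (d + 1) => (c k).coeff j).map
        fun row => (ofCoeffs row).eval x) = List.ofFn fun k => (c k).eval x := by
      rw [List.map_ofFn]
      congr 1
      ext k
      simp only [Function.comp_apply, ofCoeffs_coeff (hd k)]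
    rw [hp, coeffRows, List.map_take, h, ofCoeffs_take_of_coeff_eq_zero, ofCoeffs_ofFn, member]
    intro i hi
    rw [ofCoeffs_ofFn]
    exact coeff_member_of_lt hc x hi

/-- The cost of evaluating one member of the family and computing its subresultants. -/
def memberCost (d m : ℕ) : ℕ :=
  (m + 1) * (1 + 2 * (d + 1)) + ((4 * m + 15) * (2 * m + 1) + 2 * m + 2)

lemma runs_sRes_member (hd : ∀ k, (c k).natDegree ≤ d) (hc : ∀ k, m < k → c k = 0) {x : ℝ}
    (hx : (c m).eval x ≠ 0) :
    Runs (mapList (fun row => evalAt row x) (coeffRows d c m) >>= allSRes) (memberCost d m)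
      (· = (List.range m).map fun k => sRes k (member c x)) :=
  Runs.bind (runs_evalRows hd hc x) fun p hp => by
    rw [← hp.2]
    exact runs_allSRes hp.1 (by rw [hp.2, natDegree_member hc hx])

/-- Reversal puts the subresultant with index m - (k + 1) at position k, which belongs to the
subdiscriminant of index k + 1. -/
lemma runs_values (v : ℝ) (hv : v ≠ 0) (F : ℕ → ℝ) (n m : ℕ) :
    Runs (do
      let l ← divL ((List.range m).map F).reverse v
      let z ← zeros (n - l.length)
      pure (l ++ z)) (m + 1) fun r => ∀ k, k < n → m ≤ n →
        r[k]? = some (if k < m then F (m - (k + 1)) / v else 0) := by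
  refine Runs.le (Runs.bind (runs_divL_list hv _) fun l hl => Runs.bind (runs_zeros _) fun z hz =>
    Runs.pure ?_) (by simp)
  intro k hk hmn
  have hlen : l.length = m := by simp [hl]
  split_ifs with h
  · rw [List.getElem?_append_left (by omega), hl]
    simp [h, Nat.sub_sub, Nat.add_comm 1 k]
  · rw [List.getElem?_append_right (by omega), hz, hlen, List.getElem?_replicate, if_pos (by omega)]

/-- An upper bound for the number of steps of the algorithm. -/
def fastRRCost (n d m : ℕ) : ℕ :=
  (n + 1) * (d + 1) + ((2 * d * n + d) * (3 + 2 * (d + 1)) + (2 * d * n * memberCost d m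
    + (2 * d * n * (m + 1) + (2 * d * n * (1 + 2 * (2 * d * n))
    + n * (2 * d * n + combineCost (Nat.clog 2 (2 * d * n)))))))

theorem runs_fastRR (hn : 1 ≤ n) (hd1 : 1 ≤ d) (hd : ∀ k, (c k).natDegree ≤ d) (hcm : c m ≠ 0)
    (hc : ∀ k, m < k → c k = 0) :
    Runs (fastRR n d fun k j => (c k).coeff (j : ℕ)) (fastRRCost n d m) fun D =>
      D.points.length = 2 * d * n ∧ D.points.Nodup ∧ (∀ γ ∈ D.points, (c m).eval γ ≠ 0) ∧
      D.sres = D.points.map (fun γ => (List.range (m : ℕ)).map fun k => sRes k (member c γ)) ∧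
      ∃ q : Fin n → ℝ[X], D.output.map ofCoeffs = List.ofFn q ∧ ∀ k : Fin n,
        (q k).natDegree ≤ 2 * d * n ∧ ∀ γ : ℝ, (c m).eval γ ≠ 0 →
          (((q k).eval γ : ℝ) : ℂ) = sDisc (k + 1) (member c γ) := by
  classical
  obtain ⟨Q, hQ⟩ := exists_subdiscriminant_polynomials hn hd1 hd hc
  unfold fastRR fastRRCost
  refine Runs.bind (runs_trimRows_coeff hd hcm hc) fun rows hrows => ?_
  have hlast : rows.getLast? = some (List.ofFn fun j : Fin (d + 1) => (c m).coeff j) := by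
    rw [hrows, coeffRows_eq_append, List.getLast?_concat]
  rw [hlast]
  simp only
  set N := 2 * d * n with hN
  refine Runs.bind ((runs_goodPoints _ _).le (by rw [List.length_range, List.length_ofFn]))
    fun good hgood => ?_
  rw [ofCoeffs_coeff (hd m)] at hgood
  set pts := (((List.range (N + d)).map (Nat.cast : ℕ → ℝ)).filter
    fun x => (c m).eval x ≠ 0) with hpts
  have hnodup' : ((List.range (N + d)).map (Nat.cast : ℕ → ℝ)).Nodup :=
    List.nodup_range.map Nat.cast_injective
  have hlen' : N ≤ pts.length := by
    have h := length_le_length_filter_add_natDegree hcm hnodup'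
    rw [List.length_map, List.length_range, ← hpts] at h
    have := hd m
    omega
  rw [hgood, ← List.map_take]
  obtain ⟨xs, hxs⟩ : ∃ xs, xs = pts.take N := ⟨_, rfl⟩
  rw [← hxs]
  have hlen : xs.length = N := by rw [hxs, List.length_take, min_eq_left hlen']
  have hnodup : xs.Nodup := hxs ▸ (hnodup'.filter _).sublist (List.take_sublist _ _)
  have hne : ∀ x ∈ xs, (c m).eval x ≠ 0 := by
    intro x hx
    rw [hxs] at hx
    simpa using (List.mem_filter.1 (List.mem_of_mem_take hx)).2
  have hfst : (xs.map fun x => (x, (c m).eval x)).map Prod.fst = xs := by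
    rw [List.map_map]
    exact List.map_id xs
  have hsnd : (xs.map fun x => (x, (c m).eval x)).map Prod.snd = xs.map fun x => (c m).eval x := by
    rw [List.map_map]
    rfl
  rw [hfst, hsnd, hrows]
  refine Runs.bind ((runs_mapList (T := memberCost d m)
    (fun x => (List.range (m : ℕ)).map fun k => sRes k (member c x)) xs
    fun x hx => runs_sRes_member hd hc (hne x hx)).le (by rw [hlen])) fun sres hsres => ?_
  have hzip : (xs.map fun x => (c m).eval x).zip sres
      = xs.map fun x => ((c m).eval x, (List.range (m : ℕ)).map fun k => sRes k (member c x)) := by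
    rw [hsres]
    exact List.zip_map'
  rw [hzip]
  -- The values are stored one row per node; the postcondition reads them by columns, as the data of
  -- the k-th interpolation problem.
  refine Runs.bind (T₁ := N * (m + 1)) (Q := fun values => ∀ k, k < n →
    values.filterMap (fun row => row[k]?) = xs.map fun x => (Q k).eval x) ?_ fun values hvalues => ?_
  · refine (runs_mapList_forall₂ (T := m + 1) (Q := fun a r => ∀ k, k < n → (m : ℕ) ≤ n →
      r[k]? = some (if k < m then (a.2.getD (m - (k + 1)) 0) / a.1 else 0)) _ ?_).mono
      (by rw [List.length_map, hlen]) ?_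
    · intro a ha
      obtain ⟨x, hx, rfl⟩ := List.mem_map.1 ha
      refine (runs_values _ (hne x hx) (fun k => sRes k (member c x)) n m).mono le_rfl
        fun r hr k hk hmn => ?_
      rw [hr k hk hmn]
      split_ifs with hkm
      · rw [List.getD_eq_getElem?_getD, List.getElem?_map, List.getElem?_range (by omega)]
        rfl
      · rfl
    · intro values hvalues k hk
      rw [List.forall₂_map_left_iff] at hvalues
      refine filterMap_eq_map_of_forall₂ hvalues fun x hx r hr => ?_
      rw [hr k hk (by omega), ((hQ k hk).2 x (hne x hx)).1]
      split_ifs with hkm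
      · rw [List.getD_eq_getElem?_getD, List.getElem?_map, List.getElem?_range (by omega)]
        rfl
      · rfl
  refine Runs.bind (T₁ := N * (1 + 2 * N)) ((runs_nodeWeights [] xs (by simpa using hnodup)).le
    (by simp [hlen])) fun weights hweights => ?_
  rw [List.nil_append] at hweights
  rw [hweights]
  refine Runs.le (Runs.bind (T₂ := 0) (runs_mapList_forall₂ (T := N + combineCost (Nat.clog 2 N))
    (Q := fun k r => ofCoeffs r = Q k) _ fun k hk => ?_) fun output houtput => Runs.pure ?_)
    (by rw [List.length_range, add_zero])
  · have hk := List.mem_range.1 hk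
    rw [hvalues k hk, ← hlen]
    refine runs_interpolate hnodup ?_
    rw [hlen]
    exact (degree_le_natDegree).trans_lt (by exact_mod_cast (hQ k hk).1)
  · refine ⟨hlen, hnodup, hne, hsres, fun k => Q k, ?_, fun k => ⟨(hQ k k.2).1.le, fun γ hγ =>
      ((hQ k k.2).2 γ hγ).2⟩⟩
    rw [map_eq_map_of_forall₂ houtput]
    exact List.ext_getElem (by simp) (by simp)

/-- Every summand is compared with K = κ² n⁴. The coefficients 4, 21, 142, 4, 12 and 8402 add up to
less than 10000, and the interpolations dominate. -/
lemma fastRRCost_le {κ n d m : ℕ} (hn : 1 ≤ n) (hd1 : 1 ≤ d) (hdn : d ≤ κ * n) (hm : m ≤ n) :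
    fastRRCost n d m ≤ 10000 * κ ^ 2 * n ^ 4 := by
  have hκ : 1 ≤ κ := by
    rcases Nat.eq_zero_or_pos κ with rfl | h
    · simp at hdn
      omega
    · exact h
  have hκn : 1 ≤ κ * n := hd1.trans hdn
  set K := κ ^ 2 * n ^ 4 with hK
  have hpow : ∀ i j, i ≤ 2 → j ≤ 4 → κ ^ i * n ^ j ≤ K := fun i j hi hj =>
    Nat.mul_le_mul (Nat.pow_le_pow_right hκ hi) (Nat.pow_le_pow_right hn hj)
  have hN : 2 * d * n ≤ 2 * (κ * n ^ 2) := by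
    calc 2 * d * n ≤ 2 * (κ * n) * n := by gcongr
      _ = 2 * (κ * n ^ 2) := by ring
  have hN2 : 2 ≤ 2 * d * n := by
    calc 2 = 2 * 1 * 1 := rfl
      _ ≤ 2 * d * n := by gcongr
  have h1 : (n + 1) * (d + 1) ≤ 4 * K := by
    calc (n + 1) * (d + 1) ≤ (n + n) * (κ * n + κ * n) := by gcongr
      _ = 4 * (κ ^ 1 * n ^ 2) := by ring
      _ ≤ 4 * K := Nat.mul_le_mul_left _ (hpow _ _ (by norm_num) (by norm_num))
  have h2 : (2 * d * n + d) * (3 + 2 * (d + 1)) ≤ 21 * K := by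
    calc (2 * d * n + d) * (3 + 2 * (d + 1))
        ≤ (2 * (κ * n) * n + κ * n * n) * (3 * (κ * n) + 2 * (κ * n + κ * n)) := by
          gcongr
          · exact hdn.trans (Nat.le_mul_of_pos_right _ hn)
          · omega
      _ = 21 * (κ ^ 2 * n ^ 3) := by ring
      _ ≤ 21 * K := Nat.mul_le_mul_left _ (hpow _ _ (by norm_num) (by norm_num))
  have h3 : 2 * d * n * memberCost d m ≤ 142 * K := by
    have h : memberCost d m ≤ 71 * (κ * n ^ 2) := by
      calc memberCost d m ≤ (n + n) * (κ * n + 2 * (κ * n + κ * n))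
            + ((4 * n + 15 * n) * (2 * n + n) + 2 * (n * n) + 2 * (n * n)) := by
            unfold memberCost
            have : n ≤ n * n := Nat.le_mul_of_pos_left _ hn
            gcongr <;> omega
        _ = 10 * (κ * n ^ 2) + 61 * (1 * n ^ 2) := by ring
        _ ≤ 10 * (κ * n ^ 2) + 61 * (κ * n ^ 2) := by gcongr
        _ = 71 * (κ * n ^ 2) := by ring
    calc 2 * d * n * memberCost d m ≤ 2 * (κ * n ^ 2) * (71 * (κ * n ^ 2)) := Nat.mul_le_mul hN h
      _ = 142 * K := by rw [hK]; ring
  have h4 : 2 * d * n * (m + 1) ≤ 4 * K := by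
    calc 2 * d * n * (m + 1) ≤ 2 * (κ * n ^ 2) * (n + n) := by gcongr
      _ = 4 * (κ ^ 1 * n ^ 3) := by ring
      _ ≤ 4 * K := Nat.mul_le_mul_left _ (hpow _ _ (by norm_num) (by norm_num))
  have h5 : 2 * d * n * (1 + 2 * (2 * d * n)) ≤ 12 * K := by
    calc 2 * d * n * (1 + 2 * (2 * d * n)) ≤ 2 * d * n * (3 * (2 * d * n)) := by
          refine Nat.mul_le_mul_left _ ?_
          omega
      _ ≤ 2 * (κ * n ^ 2) * (3 * (2 * (κ * n ^ 2))) := by gcongr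
      _ = 12 * K := by rw [hK]; ring
  -- Raising κ³ to κ⁴ makes the squared bound a perfect square, with 8400² = 1050² * 8 * 2³.
  have h6 : combineCost (Nat.clog 2 (2 * d * n)) ≤ 8400 * (κ ^ 2 * n ^ 3) := by
    refine (Nat.pow_le_pow_iff_left two_ne_zero).1 ?_
    calc combineCost (Nat.clog 2 (2 * d * n)) ^ 2 ≤ 1050 ^ 2 * (8 * (2 * d * n) ^ 3) :=
          combineCost_clog_sq_le hN2
      _ ≤ 1050 ^ 2 * (8 * (2 * (κ * n ^ 2)) ^ 3) := by gcongr
      _ = 8400 ^ 2 * (κ ^ 3 * n ^ 6) := by ring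
      _ ≤ 8400 ^ 2 * (κ ^ 4 * n ^ 6) := by gcongr; omega
      _ = (8400 * (κ ^ 2 * n ^ 3)) ^ 2 := by ring
  have h7 : n * (2 * d * n + combineCost (Nat.clog 2 (2 * d * n))) ≤ 8402 * K := by
    calc n * (2 * d * n + combineCost (Nat.clog 2 (2 * d * n)))
        ≤ n * (2 * (κ * n ^ 2) + 8400 * (κ ^ 2 * n ^ 3)) :=
          Nat.mul_le_mul_left _ (Nat.add_le_add hN h6)
      _ = 2 * (κ ^ 1 * n ^ 3) + 8400 * K := by rw [hK]; ring
      _ ≤ 2 * K + 8400 * K :=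
          Nat.add_le_add_right (Nat.mul_le_mul_left _ (hpow _ _ (by norm_num) (by norm_num))) _
      _ = 8402 * K := by ring
  rw [mul_assoc, ← hK, fastRRCost]
  omega

end FastRR

end Prog

theorem mainTheorem5 :
    ∀ κ : ℕ, ∃ A : ℕ, ∀ (n d : ℕ), 1 ≤ d → d ≤ κ * n →
      ∀ (c : Fin (n + 1) → ℝ[X]) (m : Fin (n + 1)),
        (∀ k, (c k).natDegree ≤ d) → c m ≠ 0 → (∀ k, m < k → c k = 0) →
        ∃ (D : FastRRData ℝ) (t : ℕ),
          (fastRR n d fun k j => (c k).coeff (j : ℕ)).run = some (D, t) ∧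
          t ≤ A * n ^ 4 ∧
          D.points.length = 2 * d * n ∧ D.points.Nodup ∧
          (∀ γ ∈ D.points, (c m).eval γ ≠ 0) ∧
          D.sres = D.points.map
            (fun γ => (List.range (m : ℕ)).map fun k => sRes k (member c γ)) ∧
          ∃ q : Fin n → ℝ[X],
            D.output.map ofCoeffs = List.ofFn q ∧
            ∀ k : Fin n,
              (q k).natDegree ≤ 2 * d * n ∧
              ∀ γ : ℝ, (c m).eval γ ≠ 0 →
                (((q k).eval γ : ℝ) : ℂ) = sDisc (k + 1) (member c γ) := by
  intro κ
  refine ⟨10000 * κ ^ 2, fun n d hd1 hdn c m hd hcm hc => ?_⟩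
  have hn : 1 ≤ n := by
    rcases Nat.eq_zero_or_pos n with rfl | h
    · rw [mul_zero] at hdn
      omega
    · exact h
  obtain ⟨D, t, hrun, ht, hD⟩ := Prog.runs_fastRR hn hd1 hd hcm hc
  exact ⟨D, t, hrun, ht.trans (Prog.fastRRCost_le hn hd1 hdn (Nat.lt_succ_iff.1 m.2)), hD⟩
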